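/- Let $q$ be a prime power, let $m,\ell,\eta\ge 1$ be integers, $n=\ell\eta$, and $1\le k\le n$. Write $x\in\mathbb F_{q^m}^n$ as $x=[x_1|\dots|x_\ell]$ with blocks $x_i\in\mathbb F_{q^m}^\eta$. The sum-rank weight of $x$ is $\sum_{i=1}^{\ell}\dim_{\mathbb F_q}\langle x_{i,1},\dots,x_{i,\eta}\rangle_{\mathbb F_q}$, and the sum-rank distance of $x,y$ is the sum-rank weight of $x-y$. A $k$-dimensional $\mathbb F_{q^m}$-subspace $\mathcal C\subseteq\mathbb F_{q^m}^n$ with minimum sum-rank distance $d$ is called MSRD if it attains the Singleton bound, i.e. $k=\min\{n-d+1,\ \tfrac{\eta}{m}(\ell m-d+1)\}$. Let $p$ be the probability that a $k$-dimensional linear code in $\mathbb F_{q^m}^n$, chosen uniformly at random among all of them, is MSRD. Let $\begin{bmatrix}a\\b\end{bmatrix}_{q^m}$ denote the Gaussian binomial coefficient and let $\gamma_q=\prod_{i=1}^{\infty}(1-q^{-i})^{-1}$. Then $$p\le 1-\begin{bmatrix}n\\k\end{bmatrix}_{q^m}^{-1}\sum_{h=1}^{n-k}\begin{bmatrix}n-k\\h\end{bmatrix}_{q^m}\sum_{s=h}^{n-k}\begin{bmatrix}n-k-h\\s-h\end{bmatrix}_{q^m}\begin{bmatrix}n-s\\n-k\end{bmatrix}_{q^m}(-1)^{s-h}q^{m\binom{s-h}{2}},$$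 and, if $k<n$, $$p\ge 1-\frac{q^{mk}-1}{(q^m-1)(q^{mn}-1)}\left((n-k)\binom{\ell+n-k-1}{\ell-1}\gamma_q^{\ell}\,q^{(n-k)\left(m+\eta-\frac{n-k}{\ell}\right)}-1\right).$$ -/

import Mathlib

namespace SumRank

/-- The rank weight of a vector `x` over `K`: the `F`-dimension of the `F`-span of its entries. -/
noncomputable def rankWeight (F : Type*) {K : Type*} [Field F] [Field K] [Algebra F K] {η : ℕ}
    (x : Fin η → K) : ℕ :=
  Module.finrank F (Submodule.span F (Set.range x))

/-- The sum-rank weight of a vector `x = [x_1 | ... | x_ℓ]`, given by its `ℓ` blocks of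
length `η`. -/
noncomputable def sumRankWeight (F : Type*) {K : Type*} [Field F] [Field K] [Algebra F K]
    {ℓ η : ℕ} (x : Fin ℓ → Fin η → K) : ℕ :=
  ∑ i, rankWeight F (x i)

/-- The sum-rank distance. -/
noncomputable def sumRankDist (F : Type*) {K : Type*} [Field F] [Field K] [Algebra F K]
    {ℓ η : ℕ} (x y : Fin ℓ → Fin η → K) : ℕ :=
  sumRankWeight F (x - y)

/-- The minimum sum-rank distance of a linear code (used for nonzero codes only). -/
noncomputable def minDist (F : Type*) {K : Type*} [Field F] [Field K] [Algebra F K]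
    {ℓ η : ℕ} (C : Submodule K (Fin ℓ → Fin η → K)) : ℕ :=
  sInf {d | ∃ x ∈ C, ∃ y ∈ C, x ≠ y ∧ sumRankDist F x y = d}

/-- A linear code is maximum sum-rank distance (MSRD) if its dimension `k` and minimum sum-rank
distance `d` attain the Singleton bound `k ≤ min {n - d + 1, (η / m) (ℓ m - d + 1)}`, where
`n = ℓ η` and `m = [K : F]`. -/
def IsMSRD (F : Type*) {K : Type*} [Field F] [Field K] [Algebra F K]
    {ℓ η : ℕ} (C : Submodule K (Fin ℓ → Fin η → K)) : Prop :=
  (Module.finrank K C : ℚ) =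
    min (((ℓ * η : ℕ) : ℚ) - minDist F C + 1)
      ((η : ℚ) / (Module.finrank F K : ℚ) *
        ((ℓ : ℚ) * (Module.finrank F K : ℚ) - minDist F C + 1))

/-- The probability that a linear code of length `ℓ η` and dimension `k` over the finite field `K`,
chosen uniformly at random among all such codes, is MSRD. -/
noncomputable def probMSRD (F K : Type*) [Field F] [Field K] [Algebra F K] (ℓ η k : ℕ) : ℝ :=
  (Set.ncard {C : Submodule K (Fin ℓ → Fin η → K) | Module.finrank K C = k ∧ IsMSRD F C} : ℝ) /
    (Set.ncard {C : Submodule K (Fin ℓ → Fin η → K) | Module.finrank K C = k} : ℝ)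

/-- The Gaussian binomial coefficient `[a choose b]_Q` for an integer `Q ≥ 2`
(it is `0` for `b > a`, because of the factor `i = a`). -/
noncomputable def gaussBinom (Q a b : ℕ) : ℝ :=
  ∏ i ∈ Finset.range b, ((Q : ℝ) ^ a - (Q : ℝ) ^ i) / ((Q : ℝ) ^ b - (Q : ℝ) ^ i)

/-- The constant `γ_q = ∏_{i ≥ 1} (1 - q^{-i})⁻¹`. -/
noncomputable def gammaConst (q : ℕ) : ℝ :=
  ∏' i : ℕ, (1 - ((q : ℝ) ^ (i + 1))⁻¹)⁻¹

end SumRank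

/-!
Write `Q = q ^ m`, `V = K ^ n` and `t = n - k`.

*Upper bound.* The inner double sum is the number of `k`-dimensional subspaces of `V` that meet a
fixed `t`-dimensional subspace nontrivially, so the right-hand side equals `Q ^ (k t)` divided by
the number of all `k`-dimensional subspaces (`gaussBinom_eq_pow_add_sum`). It remains to see that
there are at most `Q ^ (k t)` MSRD codes. The minimum distance `d` of an MSRD code depends only on
`k`: `d - 1` is `t` if `η ≤ m` and `m t / η` otherwise. In both cases the ball of radius `d - 1`
contains an `F`-subspace `W` of dimension `m t`: let `t` coordinates be free, or confine the entries
of the `i`-th block to an `F`-subspace `U i` of `K`, where the `dim U i` sum to `d - 1`. All MSRD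
codes of dimension `k` meet `W` in zero. If `W` is a `K`-subspace, exactly `Q ^ (k t)` codes do so,
and in general there are no more (`natCard_avoiding_le`). To see this, describe a code as the common
kernel of `t` functionals `V → K`. They have to be jointly injective on `W`, and by dimensions each
of them has to map the part of `W` killed by the earlier ones onto `K`. A functional `φ` does not
map a space `U` of dimension `m s` onto `K` if `τ ∘ φ` vanishes on `U` for a fixed nonzero
`F`-linear `τ : K → F`, and this excludes at least `Q ^ (n - s)` functionals
(`natCard_dual_surjOn_le`), as many as in the case of a `K`-subspace.

*Lower bound.* The same spaces `W` prove the Singleton bound (`singleton_bound`), which shows that a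
code without nonzero words of weight at most `t` is MSRD. A code that is not MSRD therefore contains
at least `Q - 1` nonzero words of the ball of radius `t`, and every nonzero vector lies in the same
proportion `(Q ^ k - 1) / (Q ^ n - 1)` of the `k`-dimensional codes, so the union bound applies
(`natCard_not_isMSRD_mul_le`). The ball is estimated in `natCard_ball_le`: there are at most
`γ_q * q ^ (r (m + η - r))` blocks of rank weight `r`, and the Cauchy-Schwarz inequality bounds the
product over the blocks in terms of the total weight.
-/

namespace SumRank

/-! ### Gaussian binomial coefficients -/

/-- The unnormalised `Q`-factorial `∏_{i=1}^{a} (Q ^ i - 1)`. -/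
noncomputable def qFact (Q a : ℕ) : ℝ :=
  ∏ i ∈ Finset.range a, ((Q : ℝ) ^ (i + 1) - 1)

lemma qFact_succ (Q a : ℕ) : qFact Q (a + 1) = qFact Q a * ((Q : ℝ) ^ (a + 1) - 1) :=
  Finset.prod_range_succ _ _

lemma qFact_pos {Q : ℕ} (hQ : 2 ≤ Q) (a : ℕ) : 0 < qFact Q a := by
  refine Finset.prod_pos fun i _ => ?_
  have : (1 : ℝ) < (Q : ℝ) ^ (i + 1) := one_lt_pow₀ (by exact_mod_cast hQ) (by omega)
  linarith

lemma gaussBinom_zero_right (Q a : ℕ) : gaussBinom Q a 0 = 1 := by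
  simp [gaussBinom]

lemma gaussBinom_eq_zero_of_lt (Q : ℕ) {a b : ℕ} (h : a < b) : gaussBinom Q a b = 0 :=
  Finset.prod_eq_zero (Finset.mem_range.2 h) (by simp)

/-- The first product is the number of linearly independent `b`-tuples in an `a`-dimensional space
over a field with `Q` elements. -/
lemma prod_pow_sub_pow (Q : ℕ) {a b : ℕ} (h : b ≤ a) :
    (∏ i ∈ Finset.range b, ((Q : ℝ) ^ a - (Q : ℝ) ^ i)) * qFact Q (a - b) =
      (∏ i ∈ Finset.range b, (Q : ℝ) ^ i) * qFact Q a := by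
  induction b with
  | zero => simp
  | succ b ih =>
    have ih := ih (by omega)
    obtain ⟨c, rfl⟩ : ∃ c, a = b + 1 + c := ⟨a - (b + 1), by omega⟩
    have e1 : b + 1 + c - b = c + 1 := by omega
    have e2 : b + 1 + c - (b + 1) = c := by omega
    rw [e1, qFact_succ] at ih
    rw [e2, Finset.prod_range_succ, Finset.prod_range_succ]
    have e3 : (Q : ℝ) ^ (b + 1 + c) - (Q : ℝ) ^ b = (Q : ℝ) ^ b * ((Q : ℝ) ^ (c + 1) - 1) := by ring
    rw [e3]
    linear_combination (Q : ℝ) ^ b * ih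

lemma gaussBinom_eq_qFact {Q : ℕ} (hQ : 2 ≤ Q) {a b : ℕ} (h : b ≤ a) :
    gaussBinom Q a b = qFact Q a / (qFact Q b * qFact Q (a - b)) := by
  have h1 := prod_pow_sub_pow Q h
  have h2 := prod_pow_sub_pow Q (le_refl b)
  have h0 : qFact Q 0 = 1 := by simp [qFact]
  rw [Nat.sub_self, h0, mul_one] at h2
  have hp : (0 : ℝ) < ∏ i ∈ Finset.range b, (Q : ℝ) ^ i :=
    Finset.prod_pos fun i _ => by positivity
  rw [gaussBinom, Finset.prod_div_distrib, h2]
  have := qFact_pos hQ b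
  have := qFact_pos hQ (a - b)
  rw [div_eq_div_iff (by positivity) (by positivity)]
  linear_combination qFact Q b * h1

lemma gaussBinom_pos {Q : ℕ} (hQ : 2 ≤ Q) {a b : ℕ} (h : b ≤ a) : 0 < gaussBinom Q a b := by
  rw [gaussBinom_eq_qFact hQ h]
  have := qFact_pos hQ a
  have := qFact_pos hQ b
  have := qFact_pos hQ (a - b)
  positivity

lemma gaussBinom_symm {Q : ℕ} (hQ : 2 ≤ Q) {a b : ℕ} (h : b ≤ a) :
    gaussBinom Q a (a - b) = gaussBinom Q a b := by
  rw [gaussBinom_eq_qFact hQ h, gaussBinom_eq_qFact hQ (Nat.sub_le a b), Nat.sub_sub_self h,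
    mul_comm]

lemma gaussBinom_self {Q : ℕ} (hQ : 2 ≤ Q) (a : ℕ) : gaussBinom Q a a = 1 := by
  have := gaussBinom_symm hQ (le_refl a)
  rw [← this, Nat.sub_self, gaussBinom_zero_right]

/-- Pascal's rule for Gaussian binomial coefficients. -/
lemma gaussBinom_succ_succ {Q : ℕ} (hQ : 2 ≤ Q) (a b : ℕ) :
    gaussBinom Q (a + 1) (b + 1) =
      (Q : ℝ) ^ (b + 1) * gaussBinom Q a (b + 1) + gaussBinom Q a b := by
  rcases lt_trichotomy a b with h | rfl | h
  · simp [gaussBinom_eq_zero_of_lt Q h, gaussBinom_eq_zero_of_lt Q (show a + 1 < b + 1 by omega),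
      gaussBinom_eq_zero_of_lt Q (show a < b + 1 by omega)]
  · simp [gaussBinom_self hQ, gaussBinom_eq_zero_of_lt Q (Nat.lt_succ_self a)]
  · obtain ⟨c, rfl⟩ : ∃ c, a = b + 1 + c := ⟨a - (b + 1), by omega⟩
    rw [gaussBinom_eq_qFact hQ (show b + 1 ≤ b + 1 + c + 1 by omega),
      gaussBinom_eq_qFact hQ (show b + 1 ≤ b + 1 + c by omega),
      gaussBinom_eq_qFact hQ (show b ≤ b + 1 + c by omega),
      show b + 1 + c + 1 - (b + 1) = c + 1 by omega, show b + 1 + c - (b + 1) = c by omega,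
      show b + 1 + c - b = c + 1 by omega, qFact_succ, qFact_succ Q c, qFact_succ Q b]
    have h1 := (qFact_pos hQ b).ne'
    have h2 := (qFact_pos hQ c).ne'
    have h3 := (qFact_pos hQ (b + 1)).ne'
    have h4 := (qFact_pos hQ (c + 1)).ne'
    rw [qFact_succ] at h3 h4
    have h5 := right_ne_zero_of_mul h3
    have h6 := right_ne_zero_of_mul h4
    field_simp
    ring

/-- The second form of Pascal's rule. -/
lemma gaussBinom_succ_sub {Q : ℕ} (hQ : 2 ≤ Q) {a b : ℕ} (h : b ≤ a) :
    gaussBinom Q (a + 1) (b + 1) - gaussBinom Q a (b + 1) =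
      (Q : ℝ) ^ (a - b) * gaussBinom Q a b := by
  rcases h.eq_or_lt with rfl | h
  · simp [gaussBinom_self hQ, gaussBinom_eq_zero_of_lt Q (Nat.lt_succ_self b)]
  · obtain ⟨c, rfl⟩ : ∃ c, a = b + 1 + c := ⟨a - (b + 1), by omega⟩
    rw [gaussBinom_eq_qFact hQ (show b + 1 ≤ b + 1 + c + 1 by omega),
      gaussBinom_eq_qFact hQ (show b + 1 ≤ b + 1 + c by omega),
      gaussBinom_eq_qFact hQ (show b ≤ b + 1 + c by omega),
      show b + 1 + c + 1 - (b + 1) = c + 1 by omega, show b + 1 + c - (b + 1) = c by omega,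
      show b + 1 + c - b = c + 1 by omega, qFact_succ, qFact_succ Q c, qFact_succ Q b]
    have h1 := (qFact_pos hQ b).ne'
    have h2 := (qFact_pos hQ c).ne'
    have h3 := (qFact_pos hQ (b + 1)).ne'
    have h4 := (qFact_pos hQ (c + 1)).ne'
    rw [qFact_succ] at h3 h4
    have h5 := right_ne_zero_of_mul h3
    have h6 := right_ne_zero_of_mul h4
    field_simp
    ring

lemma gaussBinom_mul_gaussBinom {Q : ℕ} (hQ : 2 ≤ Q) {t s h : ℕ} (hs : s ≤ t) (hh : h ≤ s) :
    gaussBinom Q t h * gaussBinom Q (t - h) (s - h) = gaussBinom Q t s * gaussBinom Q s h := by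
  rw [gaussBinom_eq_qFact hQ (hh.trans hs), gaussBinom_eq_qFact hQ hs, gaussBinom_eq_qFact hQ hh,
    gaussBinom_eq_qFact hQ (show s - h ≤ t - h by omega), show t - h - (s - h) = t - s by omega]
  have h1 := (qFact_pos hQ s).ne'
  have h2 := (qFact_pos hQ h).ne'
  have h3 := (qFact_pos hQ (t - s)).ne'
  have h4 := (qFact_pos hQ (t - h)).ne'
  have h5 := (qFact_pos hQ (s - h)).ne'
  field_simp

/-- Summation by parts: an alternating `Q`-binomial sum lowers its order when the summand is
replaced by its difference. -/
lemma sum_gaussBinom_alternating_succ {Q : ℕ} (hQ : 2 ≤ Q) (t : ℕ) (f : ℕ → ℝ) :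
    ∑ s ∈ Finset.range (t + 2),
        gaussBinom Q (t + 1) s * (-1) ^ s * (Q : ℝ) ^ s.choose 2 * f s =
      ∑ s ∈ Finset.range (t + 1),
        gaussBinom Q t s * (-1) ^ s * (Q : ℝ) ^ s.choose 2 * ((Q : ℝ) ^ s * (f s - f (s + 1))) := by
  rw [Finset.sum_range_succ']
  simp only [gaussBinom_succ_succ hQ]
  have key : ∑ s ∈ Finset.range (t + 1),
        gaussBinom Q t s * (-1) ^ s * (Q : ℝ) ^ s.choose 2 * ((Q : ℝ) ^ s * f s) =
      ∑ s ∈ Finset.range (t + 1), gaussBinom Q t (s + 1) * (-1) ^ (s + 1) *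
        (Q : ℝ) ^ (s + 1).choose 2 * ((Q : ℝ) ^ (s + 1) * f (s + 1)) + f 0 := by
    rw [Finset.sum_range_succ', Finset.sum_range_succ (n := t),
      gaussBinom_eq_zero_of_lt Q (Nat.lt_succ_self t)]
    simp [gaussBinom_zero_right]
  simp only [mul_sub, Finset.sum_sub_distrib]
  rw [key, gaussBinom_zero_right, add_sub_right_comm, ← Finset.sum_sub_distrib]
  simp only [pow_zero, Nat.choose_zero_succ, one_mul]
  congr 1
  refine Finset.sum_congr rfl fun s _ => ?_
  have : (s + 1).choose 2 = s + s.choose 2 := by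
    rw [Nat.choose_succ_succ' s 1, Nat.choose_one_right]
  rw [this]
  ring

/-- The `Q`-binomial theorem at `-1`. -/
lemma sum_gaussBinom_alternating {Q : ℕ} (hQ : 2 ≤ Q) {t : ℕ} (ht : t ≠ 0) :
    ∑ s ∈ Finset.range (t + 1), gaussBinom Q t s * (-1) ^ s * (Q : ℝ) ^ s.choose 2 = 0 := by
  obtain ⟨t, rfl⟩ := Nat.exists_eq_succ_of_ne_zero ht
  have := sum_gaussBinom_alternating_succ hQ t (fun _ => 1)
  simpa using this

lemma sum_gaussBinom_alternating_mul {Q : ℕ} (hQ : 2 ≤ Q) (t k : ℕ) :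
    ∑ s ∈ Finset.range (t + 1),
        gaussBinom Q t s * (-1) ^ s * (Q : ℝ) ^ s.choose 2 * gaussBinom Q (t + k - s) t =
      (Q : ℝ) ^ (k * t) := by
  induction t with
  | zero => simp [gaussBinom_zero_right]
  | succ t ih =>
    rw [sum_gaussBinom_alternating_succ hQ, mul_add, pow_add, ← ih, Finset.sum_mul]
    refine Finset.sum_congr rfl fun s hs => ?_
    have hs : s ≤ t := by simpa [Nat.lt_succ_iff] using hs
    have e1 : t + 1 + k - s = (t + k - s) + 1 := by omega
    have e2 : t + 1 + k - (s + 1) = t + k - s := by omega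
    rw [e1, e2]
    by_cases h : t ≤ t + k - s
    · rw [gaussBinom_succ_sub hQ h]
      have : (Q : ℝ) ^ (k * 1) = (Q : ℝ) ^ s * (Q : ℝ) ^ (t + k - s - t) := by
        rw [← pow_add]; congr 1; omega
      rw [this]; ring
    · rw [gaussBinom_eq_zero_of_lt Q (show t + k - s < t by omega),
        gaussBinom_eq_zero_of_lt Q (show t + k - s < t + 1 by omega),
        gaussBinom_eq_zero_of_lt Q (show t + k - s + 1 < t + 1 by omega)]
      simp

/-- The number of `k`-dimensional subspaces of a `(t + k)`-dimensional space, sorted by the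
dimension `h` of the intersection with a fixed `t`-dimensional subspace: the term for `h = 0`, the
number of complements, is `Q ^ (k * t)`. -/
lemma gaussBinom_eq_pow_add_sum {Q : ℕ} (hQ : 2 ≤ Q) (t k : ℕ) :
    gaussBinom Q (t + k) t = (Q : ℝ) ^ (k * t) +
      ∑ h ∈ Finset.Icc 1 t, gaussBinom Q t h *
        ∑ s ∈ Finset.Icc h t, gaussBinom Q (t - h) (s - h) * gaussBinom Q (t + k - s) t *
          (-1 : ℝ) ^ (s - h) * (Q : ℝ) ^ (s - h).choose 2 := by
  have h0 := sum_gaussBinom_alternating_mul hQ t k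
  have hI : Finset.range (t + 1) = insert 0 (Finset.Icc 1 t) := by
    ext x; simp; omega
  have h1 : ∑ h ∈ Finset.range (t + 1), gaussBinom Q t h *
        ∑ s ∈ Finset.Icc h t, gaussBinom Q (t - h) (s - h) * gaussBinom Q (t + k - s) t *
          (-1 : ℝ) ^ (s - h) * (Q : ℝ) ^ (s - h).choose 2 = gaussBinom Q (t + k) t := by
    simp only [Finset.mul_sum]
    rw [Finset.sum_comm' (t' := Finset.range (t + 1)) (s' := fun s => Finset.range (s + 1))
      (by intro x y; simp; omega), Finset.sum_eq_single 0]
    · simp [gaussBinom_zero_right]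
    · intro s hs hs0
      have hs : s ≤ t := by simpa [Nat.lt_succ_iff] using hs
      rw [← mul_zero (gaussBinom Q t s * gaussBinom Q (t + k - s) t),
        ← sum_gaussBinom_alternating hQ hs0, Finset.mul_sum, ← Finset.sum_range_reflect]
      refine Finset.sum_congr rfl fun h hh => ?_
      have hh : h ≤ s := by simpa [Nat.lt_succ_iff] using hh
      rw [show s + 1 - 1 - h = s - h by omega, show s - (s - h) = h by omega]
      have e := gaussBinom_mul_gaussBinom hQ hs (Nat.sub_le s h)
      rw [show s - (s - h) = h by omega, gaussBinom_symm hQ hh] at e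
      linear_combination gaussBinom Q (t + k - s) t * (-1) ^ h * (Q : ℝ) ^ h.choose 2 * e
    · simp
  rw [hI, Finset.sum_insert (by simp)] at h1
  rw [← h1, ← h0]
  congr 1
  rw [gaussBinom_zero_right, one_mul]
  refine Finset.sum_congr (by ext; simp) fun s _ => ?_
  simp
  ring

/-! ### Counting subspaces over a finite field -/

/-- The linear automorphisms act transitively on the nonzero vectors, so all of these lie in
equally many `k`-dimensional subspaces. -/
lemma natCard_subspaces_mem_congr {K V : Type*} [Field K] [AddCommGroup V] [Module K V]
    {x y : V} (hx : x ≠ 0) (hy : y ≠ 0) (k : ℕ) :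
    Nat.card {C : Submodule K V // Module.finrank K C = k ∧ x ∈ C} =
      Nat.card {C : Submodule K V // Module.finrank K C = k ∧ y ∈ C} := by
  obtain ⟨g, hg⟩ := Submodule.exists_linearEquiv_restrict_eq
    ((LinearEquiv.toSpanNonzeroSingleton K V x hx).symm.trans
      (LinearEquiv.toSpanNonzeroSingleton K V y hy))
  have hg : g x = y := by
    have := hg ⟨x, Submodule.mem_span_singleton_self x⟩
    have hx' : (LinearEquiv.toSpanNonzeroSingleton K V x hx) 1 =
        ⟨x, Submodule.mem_span_singleton_self x⟩ := by
      ext; simp [LinearEquiv.toSpanNonzeroSingleton_apply]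
    rw [← this, LinearEquiv.trans_apply, ← hx', LinearEquiv.symm_apply_apply]
    simp [LinearEquiv.toSpanNonzeroSingleton_apply]
  refine Nat.card_congr ((Submodule.orderIsoMapComap g).toEquiv.subtypeEquiv fun C => ?_)
  change _ ↔ Module.finrank K (C.map (g : V →ₗ[K] V)) = k ∧ y ∈ C.map (g : V →ₗ[K] V)
  rw [LinearEquiv.finrank_map_eq g C, ← hg]
  simp

section Subspaces

variable {K V : Type*} [Field K] [Finite K] [AddCommGroup V] [Module K V] [Module.Finite K V]

lemma two_le_card (K : Type*) [Field K] [Finite K] : 2 ≤ Nat.card K :=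
  Finite.one_lt_card

lemma natCard_linearIndependent {k : ℕ} (hk : k ≤ Module.finrank K V) :
    (Nat.card {s : Fin k → V // LinearIndependent K s} : ℝ) =
      ∏ i ∈ Finset.range k, ((Nat.card K : ℝ) ^ Module.finrank K V - (Nat.card K : ℝ) ^ i) := by
  have := Fintype.ofFinite K
  have : Finite V := Module.finite_of_finite K
  rw [card_linearIndependent hk, Fintype.card_eq_nat_card, Nat.cast_prod,
    ← Fin.prod_univ_eq_prod_range
    (fun i => (Nat.card K : ℝ) ^ Module.finrank K V - (Nat.card K : ℝ) ^ i)]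
  refine Finset.prod_congr rfl fun i _ => ?_
  rw [Nat.cast_sub (Nat.pow_le_pow_right Nat.card_pos (by omega))]
  simp

/-- Linearly independent `k`-tuples spanning a given `k`-dimensional subspace `C` are linearly
independent `k`-tuples in `C`. -/
def linearIndependentSpanEquiv {k : ℕ} {C : Submodule K V} (hC : Module.finrank K C = k) :
    {s : Fin k → V // LinearIndependent K s ∧ Submodule.span K (Set.range s) = C} ≃
      {s : Fin k → C // LinearIndependent K s} where
  toFun s := ⟨fun i => ⟨s.1 i, s.2.2.le (Submodule.subset_span ⟨i, rfl⟩)⟩,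
    LinearIndependent.of_comp C.subtype s.2.1⟩
  invFun s := ⟨fun i => s.1 i, s.2.map' C.subtype C.ker_subtype, by
    have hli : LinearIndependent K (fun i => (s.1 i : V)) := s.2.map' C.subtype C.ker_subtype
    refine Submodule.eq_of_le_of_finrank_eq ?_ ?_
    · rw [Submodule.span_le]
      rintro _ ⟨i, rfl⟩
      exact (s.1 i).2
    · rw [finrank_span_eq_card hli, hC, Fintype.card_fin]⟩
  left_inv _ := rfl
  right_inv _ := rfl

/-- Each `k`-dimensional subspace has the same number of bases, so subspaces with a property `P`
are counted by the linearly independent tuples whose span has the property. -/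
lemma natCard_subspaces_mul (P : Submodule K V → Prop) (k : ℕ) :
    (Nat.card {C : Submodule K V // Module.finrank K C = k ∧ P C} : ℝ) *
        ∏ i ∈ Finset.range k, ((Nat.card K : ℝ) ^ k - (Nat.card K : ℝ) ^ i) =
      Nat.card {s : Fin k → V //
        LinearIndependent K s ∧ P (Submodule.span K (Set.range s))} := by
  have : Finite V := Module.finite_of_finite K
  have : Finite (Submodule K V) := Finite.of_injective _ SetLike.coe_injective
  have := Fintype.ofFinite {C : Submodule K V // Module.finrank K C = k ∧ P C}
  let e : (Σ C : {C : Submodule K V // Module.finrank K C = k ∧ P C},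
      {s : Fin k → C.1 // LinearIndependent K s}) ≃ {s : Fin k → V //
        LinearIndependent K s ∧ P (Submodule.span K (Set.range s))} :=
    (Equiv.sigmaCongrRight fun C => (linearIndependentSpanEquiv C.2.1).symm).trans
    { toFun x := ⟨x.2.1, x.2.2.1, x.2.2.2.symm ▸ x.1.2.2⟩
      invFun s := ⟨⟨Submodule.span K (Set.range s.1), by
        rw [finrank_span_eq_card s.2.1, Fintype.card_fin], s.2.2⟩, s.1, s.2.1, rfl⟩
      left_inv := by
        rintro ⟨⟨C, hC⟩, s, hs, h⟩
        obtain rfl : Submodule.span K (Set.range s) = C := h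
        rfl
      right_inv _ := rfl }
  rw [← Nat.card_congr e, Nat.card_sigma, Nat.cast_sum, Finset.sum_congr rfl (g := fun _ =>
    ∏ i ∈ Finset.range k, ((Nat.card K : ℝ) ^ k - (Nat.card K : ℝ) ^ i))]
  · simp [Nat.card_eq_fintype_card]
  · rintro ⟨C, hC, _⟩ _
    rw [natCard_linearIndependent hC.ge, hC]

lemma prod_pow_sub_pow_pos {Q : ℕ} (hQ : 2 ≤ Q) (k : ℕ) :
    0 < ∏ i ∈ Finset.range k, ((Q : ℝ) ^ k - (Q : ℝ) ^ i) := by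
  refine Finset.prod_pos fun i hi => sub_pos.2 ?_
  exact pow_lt_pow_right₀ (by exact_mod_cast hQ) (Finset.mem_range.1 hi)

lemma natCard_subspaces {k : ℕ} (hk : k ≤ Module.finrank K V) :
    (Nat.card {C : Submodule K V // Module.finrank K C = k} : ℝ) =
      gaussBinom (Nat.card K) (Module.finrank K V) k := by
  have h := natCard_subspaces_mul (K := K) (V := V) (fun _ => True) k
  simp only [and_true] at h
  rw [natCard_linearIndependent hk] at h
  rw [gaussBinom, Finset.prod_div_distrib, ← h, mul_div_cancel_right₀]
  exact (prod_pow_sub_pow_pos (two_le_card K) k).ne'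

/-- The proportion of the `k`-dimensional subspaces that contain a given nonzero vector. -/
lemma natCard_subspaces_mem_mul {x : V} (hx : x ≠ 0) {k : ℕ} :
    (Nat.card {C : Submodule K V // Module.finrank K C = k ∧ x ∈ C} : ℝ) *
        ((Nat.card K : ℝ) ^ Module.finrank K V - 1) =
      Nat.card {C : Submodule K V // Module.finrank K C = k} * ((Nat.card K : ℝ) ^ k - 1) := by
  classical
  have : Finite V := Module.finite_of_finite K
  have : Finite (Submodule K V) := Finite.of_injective _ SetLike.coe_injective
  have := Fintype.ofFinite V
  have := Fintype.ofFinite (Submodule K V)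
  have hcompl (C : Submodule K V) : ({y | y ≠ 0 ∧ y ∈ C} : Finset V).card + 1 =
      Nat.card K ^ Module.finrank K C := by
    rw [← Module.natCard_eq_pow_finrank, Nat.card_eq_fintype_card, Fintype.card_subtype,
      ← Finset.card_insert_of_notMem (a := (0 : V)) (by simp)]
    congr 1
    ext y
    by_cases hy : y = 0 <;> simp [hy]
  have hV := hcompl ⊤
  rw [finrank_top] at hV
  -- count the pairs `(y, C)` with `0 ≠ y ∈ C` in two ways
  have key := Finset.sum_card_bipartiteAbove_eq_sum_card_bipartiteBelow
    (s := ({y | y ≠ 0} : Finset V)) (t := ({C | Module.finrank K C = k} : Finset (Submodule K V)))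
    (fun y C => y ∈ C)
  rw [Finset.sum_const_nat (m := Nat.card {C : Submodule K V // Module.finrank K C = k ∧ x ∈ C}),
    Finset.sum_const_nat (m := Nat.card K ^ k - 1)] at key
  · have h1 : ({y | y ≠ 0} : Finset V) = ({y | y ≠ 0 ∧ y ∈ (⊤ : Submodule K V)} : Finset V) := by
      simp
    rw [h1, Nat.eq_sub_of_add_eq hV, ← Fintype.card_subtype, ← Nat.card_eq_fintype_card] at key
    have hQ := two_le_card K
    have key := congrArg (Nat.cast (R := ℝ)) key
    push_cast [Nat.cast_sub (Nat.one_le_pow k (Nat.card K) (by omega)),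
      Nat.cast_sub (Nat.one_le_pow (Module.finrank K V) (Nat.card K) (by omega))] at key
    linarith
  · intro C hC
    have hC : Module.finrank K C = k := by simpa using hC
    rw [← hC, ← hcompl C, Finset.bipartiteBelow, Finset.filter_filter, Nat.add_sub_cancel]
  · intro y hy
    have hy : y ≠ 0 := by simpa using hy
    rw [natCard_subspaces_mem_congr hx hy, Finset.bipartiteAbove, Finset.filter_filter,
      Nat.card_eq_fintype_card, Fintype.card_subtype]

end Subspaces
/-! ### Codes that meet a fixed `F`-subspace trivially -/

section Avoiding

variable {F K V : Type*} [Field F] [Finite F] [Field K] [Finite K] [Algebra F K]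
  [AddCommGroup V] [Module K V] [Module F V] [IsScalarTower F K V] [Module.Finite K V]

/-- A functional `φ` fails to map `W` onto `K` as soon as a fixed nonzero `F`-linear `τ : K → F`
satisfies `τ ∘ φ = 0` on `W`; such `φ` form an `F`-subspace of codimension at most `dim W`. -/
lemma natCard_dual_surjOn_le (W : Submodule F V) {r : ℕ}
    (hW : Module.finrank F W = Module.finrank F K * r) :
    Nat.card {φ : Module.Dual K V // ∀ c, ∃ x ∈ W, φ x = c} ≤
      Nat.card K ^ Module.finrank K V - Nat.card K ^ (Module.finrank K V - r) := by
  classical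
  have : Module.Finite F K := Module.Finite.of_finite
  have : Module.Finite F V := Module.Finite.trans K V
  have : Finite (Module.Dual K V) := Module.finite_of_finite K
  obtain ⟨τ, hτ⟩ : ∃ τ : K →ₗ[F] F, τ 1 ≠ 0 := by
    by_contra! h
    exact one_ne_zero ((Module.forall_dual_apply_eq_zero_iff F (1 : K)).1 h)
  let Ψ : Module.Dual K V →ₗ[F] Module.Dual F W :=
    { toFun φ := τ ∘ₗ (φ.restrictScalars F) ∘ₗ W.subtype
      map_add' φ ψ := by ext x; simp
      map_smul' c φ := by ext x; simp }
  have hrank := Ψ.finrank_range_add_finrank_ker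
  have hle := Submodule.finrank_le (LinearMap.range Ψ)
  have hdual : Module.finrank F (Module.Dual K V) = Module.finrank F K * Module.finrank K V := by
    rw [← Module.finrank_mul_finrank F K, Subspace.dual_finrank_eq]
  rw [Subspace.dual_finrank_eq, hW] at hle
  rw [hdual] at hrank
  have hker : Nat.card K ^ (Module.finrank K V - r) ≤ Nat.card (LinearMap.ker Ψ) := by
    rw [Module.natCard_eq_pow_finrank (K := F) (V := LinearMap.ker Ψ),
      Module.natCard_eq_pow_finrank (K := F) (V := K), ← pow_mul, Nat.mul_sub]
    exact Nat.pow_le_pow_right Nat.card_pos (by omega)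
  have htot : Nat.card (Module.Dual K V) = Nat.card K ^ Module.finrank K V := by
    rw [Module.natCard_eq_pow_finrank (K := K), Subspace.dual_finrank_eq]
  have hdisj : Disjoint {φ : Module.Dual K V | ∀ c, ∃ x ∈ W, φ x = c}
      (LinearMap.ker Ψ : Set (Module.Dual K V)) := by
    rw [Set.disjoint_left]
    intro φ hφ hk
    obtain ⟨x, hx, h1⟩ := hφ 1
    have : Ψ φ ⟨x, hx⟩ = 0 := by rw [LinearMap.mem_ker.1 hk]; rfl
    apply hτ
    rw [← h1]
    exact this
  have hsum := Set.ncard_union_eq hdisj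
  have hle2 := Set.ncard_le_card ({φ : Module.Dual K V | ∀ c, ∃ x ∈ W, φ x = c} ∪
      (LinearMap.ker Ψ : Set (Module.Dual K V)))
  have e1 : Set.ncard {φ : Module.Dual K V | ∀ c, ∃ x ∈ W, φ x = c} =
    Nat.card {φ : Module.Dual K V // ∀ c, ∃ x ∈ W, φ x = c} := rfl
  have e2 : Set.ncard (LinearMap.ker Ψ : Set (Module.Dual K V)) =
    Nat.card (LinearMap.ker Ψ) := rfl
  omega

/-- The number of `t`-tuples of `K`-linear functionals that are jointly injective on an
`F`-subspace `W` of dimension `m t`. Each functional in turn has to map what is left of `W` onto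
`K`, and what is left then loses exactly `m = [K : F]` dimensions. -/
lemma natCard_tuples_injOn_le (t : ℕ) (W : Submodule F V)
    (hW : Module.finrank F W = Module.finrank F K * t) (ht : t ≤ Module.finrank K V) :
    Nat.card {a : Fin t → Module.Dual K V // ∀ x ∈ W, (∀ i, a i x = 0) → x = 0} ≤
      ∏ s ∈ Finset.range t,
        (Nat.card K ^ Module.finrank K V - Nat.card K ^ (Module.finrank K V - (s + 1))) := by
  classical
  have : Module.Finite F K := Module.Finite.of_finite
  have : Module.Finite F V := Module.Finite.trans K V
  have : Finite (Module.Dual K V) := Module.finite_of_finite K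
  induction t generalizing W with
  | zero =>
    rw [Finset.range_zero, Finset.prod_empty]
    exact Finite.card_le_one_iff_subsingleton.2 inferInstance
  | succ t ih =>
    let G (φ : Module.Dual K V) : Submodule F V := W ⊓ LinearMap.ker (φ.restrictScalars F)
    -- rank-nullity for the restriction of `φ` to `W`
    have hG (φ : Module.Dual K V) : ∃ R : Submodule F K,
        Module.finrank F R + Module.finrank F (G φ) = Module.finrank F K * (t + 1) ∧
        (R = ⊤ → ∀ c, ∃ x ∈ W, φ x = c) := by
      refine ⟨LinearMap.range ((φ.restrictScalars F).domRestrict W), ?_, fun h c => ?_⟩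
      · rw [← hW, ← ((φ.restrictScalars F).domRestrict W).finrank_range_add_finrank_ker]
        congr 1
        rw [LinearMap.ker_domRestrict]
        refine LinearEquiv.finrank_eq (LinearEquiv.symm ((LinearEquiv.ofEq _ _ ?_).trans
          (Submodule.comapSubtypeEquivOfLe (inf_le_left : G φ ≤ W))))
        ext x
        simp [G]
      · obtain ⟨x, hx⟩ := LinearMap.range_eq_top.1 h c
        exact ⟨x, x.2, hx⟩
    have hgood (a : Fin (t + 1) → Module.Dual K V)
        (ha : ∀ x ∈ W, (∀ i, a i x = 0) → x = 0) :
        (∀ x ∈ G (a 0), (∀ i, Fin.tail a i x = 0) → x = 0) := by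
      intro x hx h
      exact ha x hx.1 (Fin.cases hx.2 h)
    -- the remaining `t` functionals embed `G φ` into `K ^ t`
    have hdim (φ : Module.Dual K V) (b : Fin t → Module.Dual K V)
        (hb : ∀ x ∈ G φ, (∀ i, b i x = 0) → x = 0) :
        Module.finrank F (G φ) ≤ Module.finrank F K * t := by
      let f : G φ →ₗ[F] (Fin t → K) := LinearMap.pi fun i => (b i).restrictScalars F ∘ₗ (G φ).subtype
      have hf : Function.Injective f := by
        rw [← LinearMap.ker_eq_bot, LinearMap.ker_eq_bot']
        intro x hx
        exact Subtype.ext (hb x x.2 fun i => congrFun hx i)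
      have := LinearMap.finrank_le_finrank_of_injective hf
      rwa [Module.finrank_pi_fintype, Finset.sum_const, Finset.card_univ, Fintype.card_fin,
        smul_eq_mul, mul_comm] at this
    -- `φ` lowers the dimension of `W` by at most `m`, so both bounds on the dimension are attained
    have hsurj (φ : Module.Dual K V) (b : Fin t → Module.Dual K V)
        (hb : ∀ x ∈ G φ, (∀ i, b i x = 0) → x = 0) :
        (∀ c, ∃ x ∈ W, φ x = c) ∧ Module.finrank F (G φ) = Module.finrank F K * t := by
      obtain ⟨R, h1, h2⟩ := hG φ
      have h3 := hdim φ b hb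
      have h4 := Submodule.finrank_le R
      rw [mul_add, mul_one] at h1
      exact ⟨h2 (Submodule.eq_top_of_finrank_eq (by omega)), by omega⟩
    have := Fintype.ofFinite {φ : Module.Dual K V // ∀ c, ∃ x ∈ W, φ x = c}
    let ι : {a : Fin (t + 1) → Module.Dual K V // ∀ x ∈ W, (∀ i, a i x = 0) → x = 0} →
        Σ φ : {φ : Module.Dual K V // ∀ c, ∃ x ∈ W, φ x = c},
          {b : Fin t → Module.Dual K V // ∀ x ∈ G φ.1, (∀ i, b i x = 0) → x = 0} :=
      fun a => ⟨⟨a.1 0, (hsurj _ _ (hgood a.1 a.2)).1⟩, ⟨Fin.tail a.1, hgood a.1 a.2⟩⟩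
    have hι : Function.Injective ι := by
      intro a a' h
      have h0 : a.1 0 = a'.1 0 := congrArg (fun z => z.1.1) h
      have h1 : Fin.tail a.1 = Fin.tail a'.1 := congrArg (fun z => z.2.1) h
      refine Subtype.ext ?_
      rw [← Fin.cons_self_tail a.1, ← Fin.cons_self_tail a'.1, h0, h1]
    refine (Nat.card_le_card_of_injective ι hι).trans ?_
    rw [Nat.card_sigma, Finset.prod_range_succ, mul_comm]
    refine (Finset.sum_le_card_nsmul _ _ _ fun φ _ => ?_).trans
      (Nat.mul_le_mul_right _ ?_)
    -- if `G φ` is too large, no tuple completes `φ`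
    · by_cases hφ : Module.finrank F (G φ.1) = Module.finrank F K * t
      · exact ih (G φ.1) hφ (by omega)
      · have : IsEmpty {b : Fin t → Module.Dual K V //
            ∀ x ∈ G φ.1, (∀ i, b i x = 0) → x = 0} :=
          ⟨fun b => hφ (hsurj φ.1 b.1 b.2).2⟩
        simp
    · rw [Finset.card_univ, ← Nat.card_eq_fintype_card]
      exact natCard_dual_surjOn_le W hW

/-- Among the `k`-dimensional codes, at most as many avoid an `F`-subspace `W` of `F`-codimension
`m k` as avoid a `K`-subspace of `K`-codimension `k`. -/
lemma natCard_avoiding_le {t k : ℕ} (hV : Module.finrank K V = t + k) (W : Submodule F V)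
    (hW : Module.finrank F W = Module.finrank F K * t) :
    (Nat.card {C : Submodule K V // Module.finrank K C = k ∧ ∀ x ∈ W, x ∈ C → x = 0} : ℝ) ≤
      (Nat.card K : ℝ) ^ (k * t) := by
  have hQ := two_le_card K
  have : Finite (Module.Dual K V) := Module.finite_of_finite K
  let P : Submodule K (Module.Dual K V) → Prop := fun D => ∀ x ∈ W, x ∈ D.dualCoannihilator → x = 0
  -- count codes through their annihilators, whose bases are tuples of functionals
  have hcard : Nat.card {C : Submodule K V // Module.finrank K C = k ∧ ∀ x ∈ W, x ∈ C → x = 0} =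
      Nat.card {D : Submodule K (Module.Dual K V) // Module.finrank K D = t ∧ P D} := by
    refine Nat.card_congr ((Subspace.orderIsoFiniteDimensional (K := K)
      (V := V)).toEquiv.trans OrderDual.ofDual |>.subtypeEquiv fun C => ?_)
    change _ ↔ Module.finrank K C.dualAnnihilator = t ∧
      ∀ x ∈ W, x ∈ C.dualAnnihilator.dualCoannihilator → x = 0
    rw [Subspace.dualAnnihilator_dualCoannihilator_eq]
    have := Subspace.finrank_add_finrank_dualAnnihilator_eq C
    refine and_congr_left fun _ => ?_
    omega
  have h1 := natCard_subspaces_mul P t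
  have h2 : Nat.card {s : Fin t → Module.Dual K V //
        LinearIndependent K s ∧ P (Submodule.span K (Set.range s))} ≤
      Nat.card {a : Fin t → Module.Dual K V // ∀ x ∈ W, (∀ i, a i x = 0) → x = 0} := by
    refine Nat.card_le_card_of_injective (fun s => ⟨s.1, fun x hx h => s.2.2 x hx ?_⟩) ?_
    · rw [Submodule.mem_dualCoannihilator]
      intro φ hφ
      induction hφ using Submodule.span_induction with
      | mem φ h' => obtain ⟨i, rfl⟩ := h'; exact h i
      | zero => rfl
      | add φ ψ _ _ h1 h2 => simp [h1, h2]
      | smul c φ _ h1 => simp [h1]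
    · intro s s' h
      exact Subtype.ext (congrArg (fun z => z.1) h)
  have h3 := h2.trans (natCard_tuples_injOn_le t W hW (by omega))
  have h4 : ((∏ s ∈ Finset.range t,
        (Nat.card K ^ Module.finrank K V - Nat.card K ^ (Module.finrank K V - (s + 1))) : ℕ) : ℝ) =
      (Nat.card K : ℝ) ^ (k * t) *
        ∏ i ∈ Finset.range t, ((Nat.card K : ℝ) ^ t - (Nat.card K : ℝ) ^ i) := by
    have h5 : (Nat.card K : ℝ) ^ (k * t) = ∏ i ∈ Finset.range t, (Nat.card K : ℝ) ^ k := by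
      simp [pow_mul]
    rw [h5, ← Finset.prod_mul_distrib, Nat.cast_prod, ← Finset.prod_range_reflect]
    refine Finset.prod_congr rfl fun i hi => ?_
    have hi := Finset.mem_range.1 hi
    rw [hV, Nat.cast_sub (Nat.pow_le_pow_right (by omega) (by omega)),
      show t + k - (t - 1 - i + 1) = k + i by omega]
    push_cast
    ring
  rw [hcard]
  have h6 := prod_pow_sub_pow_pos hQ t
  refine le_of_mul_le_mul_right ?_ h6
  rw [h1, ← h4]
  exact_mod_cast h3

end Avoiding
/-! ### Balls in the sum-rank metric -/

section Gamma

variable {q : ℕ}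

lemma inv_pow_succ_le_half (hq : 2 ≤ q) (i : ℕ) : ((q : ℝ) ^ (i + 1))⁻¹ ≤ 1 / 2 := by
  have hq' : (2 : ℝ) ≤ q := by exact_mod_cast hq
  rw [one_div]
  refine inv_anti₀ two_pos (hq'.trans ?_)
  exact le_self_pow₀ (by linarith) (by omega)

lemma one_le_gammaFactor (hq : 2 ≤ q) (i : ℕ) : 1 ≤ (1 - ((q : ℝ) ^ (i + 1))⁻¹)⁻¹ := by
  have h := inv_pow_succ_le_half hq i
  have h0 : (0 : ℝ) ≤ ((q : ℝ) ^ (i + 1))⁻¹ := by positivity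
  exact (one_le_inv₀ (by linarith)).2 (by linarith)

lemma multipliable_gammaFactor (hq : 2 ≤ q) :
    Multipliable fun i : ℕ => (1 - ((q : ℝ) ^ (i + 1))⁻¹)⁻¹ := by
  have hq' : (2 : ℝ) ≤ q := by exact_mod_cast hq
  -- `1 / (1 - x) - 1 ≤ 2 x` for `0 ≤ x ≤ 1 / 2`
  have hs : Summable fun i : ℕ => 2 * ((q : ℝ)⁻¹) ^ (i + 1) :=
    ((summable_nat_add_iff 1).2 (summable_geometric_of_lt_one (by positivity)
      (inv_lt_one_of_one_lt₀ (by linarith)))).mul_left 2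
  have : Multipliable fun i : ℕ => 1 + ((1 - ((q : ℝ) ^ (i + 1))⁻¹)⁻¹ - 1) := by
    refine Real.multipliable_one_add_of_summable (hs.of_nonneg_of_le (fun i => ?_) fun i => ?_)
    · exact sub_nonneg.2 (one_le_gammaFactor hq i)
    · have h := inv_pow_succ_le_half hq i
      have h0 : (0 : ℝ) ≤ ((q : ℝ) ^ (i + 1))⁻¹ := by positivity
      rw [inv_pow, sub_le_iff_le_add, inv_le_comm₀ (by linarith) (by positivity),
        inv_le_iff_one_le_mul₀ (by positivity)]
      nlinarith
  simpa using this

lemma prod_range_le_gammaConst (hq : 2 ≤ q) (r : ℕ) :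
    ∏ i ∈ Finset.range r, (1 - ((q : ℝ) ^ (i + 1))⁻¹)⁻¹ ≤ gammaConst q := by
  have hmono : Monotone fun r : ℕ => ∏ i ∈ Finset.range r, (1 - ((q : ℝ) ^ (i + 1))⁻¹)⁻¹ := by
    refine monotone_nat_of_le_succ fun r => ?_
    rw [Finset.prod_range_succ]
    refine le_mul_of_one_le_right (Finset.prod_nonneg fun i _ => ?_) (one_le_gammaFactor hq r)
    exact zero_le_one.trans (one_le_gammaFactor hq i)
  exact hmono.ge_of_tendsto (multipliable_gammaFactor hq).hasProd.tendsto_prod_nat r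

lemma one_le_gammaConst (hq : 2 ≤ q) : 1 ≤ gammaConst q := by
  simpa using prod_range_le_gammaConst hq 0

/-- The product defining `gaussBinom q a r` is bounded factor by factor, `q ^ a - q ^ i` being
replaced by `q ^ a`. -/
lemma gaussBinom_le_gammaConst_mul (hq : 2 ≤ q) {a r : ℕ} (hr : r ≤ a) :
    gaussBinom q a r ≤ gammaConst q * (q : ℝ) ^ (r * (a - r)) := by
  have hq' : (1 : ℝ) < q := by exact_mod_cast hq
  refine le_trans ?_ (mul_le_mul_of_nonneg_right (prod_range_le_gammaConst hq r) (by positivity))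
  rw [mul_comm r, pow_mul, ← Finset.prod_range_reflect, gaussBinom]
  have : ((q : ℝ) ^ (a - r)) ^ r = ∏ i ∈ Finset.range r, (q : ℝ) ^ (a - r) := by simp
  rw [this, ← Finset.prod_mul_distrib]
  refine Finset.prod_le_prod (fun i hi => ?_) fun i hi => ?_
  all_goals have hi := Finset.mem_range.1 hi
  all_goals have h1 : (0 : ℝ) < (q : ℝ) ^ r - (q : ℝ) ^ i := sub_pos.2 (pow_lt_pow_right₀ hq' hi)
  · have : (q : ℝ) ^ i ≤ (q : ℝ) ^ a := pow_le_pow_right₀ hq'.le (by omega)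
    exact div_nonneg (by linarith) h1.le
  · have e1 : (q : ℝ) ^ r = (q : ℝ) ^ i * (q : ℝ) ^ (r - 1 - i + 1) := by
      rw [← pow_add]; congr 1; omega
    have e2 : (q : ℝ) ^ a = (q : ℝ) ^ (a - r) * (q : ℝ) ^ r := by
      rw [← pow_add]; congr 1; omega
    have h2 : (0 : ℝ) < (q : ℝ) ^ (r - 1 - i + 1) - 1 := by
      have : (1 : ℝ) < (q : ℝ) ^ (r - 1 - i + 1) := one_lt_pow₀ hq' (by omega)
      linarith
    have e3 : (1 - ((q : ℝ) ^ (r - 1 - i + 1))⁻¹)⁻¹ * (q : ℝ) ^ (a - r) =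
        (q : ℝ) ^ a / ((q : ℝ) ^ r - (q : ℝ) ^ i) := by
      rw [e1] at h1 ⊢
      rw [e2, e1]
      have h3 := h2.ne'
      have h4 := h1.ne'
      have h5 : (q : ℝ) ^ (r - 1 - i + 1) ≠ 0 := by positivity
      have h6 : 1 - ((q : ℝ) ^ (r - 1 - i + 1))⁻¹ ≠ 0 := by
        intro h; apply h3; field_simp at h; linarith
      field_simp
    rw [e3]
    refine div_le_div_of_nonneg_right ?_ h1.le
    have : (0 : ℝ) ≤ (q : ℝ) ^ i := by positivity
    linarith

end Gamma

/-- The number of ways to write `s` as an ordered sum of `ℓ` natural numbers. -/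
lemma card_piAntidiag_fin (ℓ s : ℕ) (hℓ : 1 ≤ ℓ) :
    (Finset.piAntidiag (Finset.univ : Finset (Fin ℓ)) s).card = (ℓ + s - 1).choose (ℓ - 1) := by
  rw [← Finset.map_sym_eq_piAntidiag, Finset.card_map, Finset.sym_univ, Finset.card_univ,
    Sym.card_sym_eq_choose, Fintype.card_fin]
  exact Nat.choose_symm_of_eq_add (by omega)

section WeightBasics

variable {F K : Type*} [Field F] [Field K] [Finite K] [Algebra F K] {η ℓ : ℕ}

lemma rankWeight_le_finrank (x : Fin η → K) : rankWeight F x ≤ Module.finrank F K := by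
  have : Module.Finite F K := Module.Finite.of_finite
  exact Submodule.finrank_le _

lemma rankWeight_eq_zero {x : Fin η → K} : rankWeight F x = 0 ↔ x = 0 := by
  have : Module.Finite F K := Module.Finite.of_finite
  rw [rankWeight, Submodule.finrank_eq_zero, Submodule.span_eq_bot, funext_iff]
  simp

lemma sumRankWeight_eq_zero {x : Fin ℓ → Fin η → K} : sumRankWeight F x = 0 ↔ x = 0 := by
  simp [sumRankWeight, rankWeight_eq_zero (F := F), funext_iff]

lemma sumRankWeight_le (x : Fin ℓ → Fin η → K) :
    sumRankWeight F x ≤ ℓ * Module.finrank F K := by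
  refine (Finset.sum_le_card_nsmul _ _ _ fun i _ => rankWeight_le_finrank (x i)).trans ?_
  simp

/-- Vectors of sum-rank weight `s`, sorted by the rank weights of their blocks. -/
lemma natCard_sumRankWeight_eq (s : ℕ) :
    Nat.card {x : Fin ℓ → Fin η → K // sumRankWeight F x = s} =
      ∑ c ∈ Finset.piAntidiag (Finset.univ : Finset (Fin ℓ)) s,
        ∏ i, Nat.card {x : Fin η → K // rankWeight F x = c i} := by
  classical
  have := Fintype.ofFinite K
  rw [Nat.card_eq_fintype_card, Fintype.card_subtype,
    Finset.card_eq_sum_card_fiberwise (f := fun x i => rankWeight F (x i))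
      (t := Finset.piAntidiag (Finset.univ : Finset (Fin ℓ)) s)]
  · refine Finset.sum_congr rfl fun c hc => ?_
    simp only [Nat.card_eq_fintype_card, Fintype.card_subtype]
    rw [← Fintype.card_piFinset]
    congr 1
    ext x
    have hc : ∑ i, c i = s := by simpa using hc
    simp only [Finset.mem_filter, Finset.mem_univ, true_and, Fintype.mem_piFinset, funext_iff,
      and_iff_right_iff_imp]
    intro h
    rw [sumRankWeight, ← hc]
    exact Finset.sum_congr rfl fun i _ => h i
  · intro x hx
    have hx : ∑ i, rankWeight F (x i) = s := (Finset.mem_filter.1 hx).2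
    simpa using hx

end WeightBasics

section Weights

variable {F K : Type*} [Field F] [Finite F] [Field K] [Finite K] [Algebra F K] {η ℓ : ℕ}

/-- Vectors of rank weight `r`, counted by the span of their entries. -/
lemma natCard_rankWeight_le (r : ℕ) (hr : r ≤ Module.finrank F K) :
    (Nat.card {x : Fin η → K // rankWeight F x = r} : ℝ) ≤
      gaussBinom (Nat.card F) (Module.finrank F K) r * (Nat.card F : ℝ) ^ (r * η) := by
  have : Module.Finite F K := Module.Finite.of_finite
  have : Finite (Submodule F K) := Finite.of_injective _ SetLike.coe_injective
  have := Fintype.ofFinite {U : Submodule F K // Module.finrank F U = r}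
  let ι : {x : Fin η → K // rankWeight F x = r} →
      Σ U : {U : Submodule F K // Module.finrank F U = r}, (Fin η → U.1) :=
    fun x => ⟨⟨Submodule.span F (Set.range x.1), x.2⟩,
      fun i => ⟨x.1 i, Submodule.subset_span ⟨i, rfl⟩⟩⟩
  have hι : Function.Injective ι := by
    intro x y h
    have : (fun i => ((ι x).2 i : K)) = fun i => ((ι y).2 i : K) := by rw [h]
    exact Subtype.ext this
  have h := Nat.card_le_card_of_injective ι hι
  rw [Nat.card_sigma, Finset.sum_const_nat (m := Nat.card F ^ (r * η)), Finset.card_univ,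
    ← Nat.card_eq_fintype_card] at h
  · rw [← natCard_subspaces hr]
    exact_mod_cast h
  · rintro ⟨U, hU⟩ _
    rw [Nat.card_fun, Module.natCard_eq_pow_finrank (K := F) (V := U), hU, Nat.card_fin, pow_mul]

lemma natCard_rankWeight_le_rpow (r : ℕ) :
    (Nat.card {x : Fin η → K // rankWeight F x = r} : ℝ) ≤
      gammaConst (Nat.card F) *
        (Nat.card F : ℝ) ^ ((r : ℝ) * ((Module.finrank F K : ℝ) + η - r)) := by
  have hq := two_le_card F
  have hγ := one_le_gammaConst hq
  by_cases hr : r ≤ Module.finrank F K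
  · refine (natCard_rankWeight_le r hr).trans ?_
    refine (mul_le_mul_of_nonneg_right (gaussBinom_le_gammaConst_mul hq hr)
      (by positivity)).trans_eq ?_
    rw [mul_assoc, ← pow_add, ← Real.rpow_natCast]
    push_cast [Nat.cast_sub hr]
    ring_nf
  · have : IsEmpty {x : Fin η → K // rankWeight F x = r} :=
      ⟨fun x => hr (x.2 ▸ rankWeight_le_finrank x.1)⟩
    rw [Nat.card_of_isEmpty, Nat.cast_zero]
    positivity

/-- The slack in the bound on the number of vectors of rank weight one also accounts for the zero
vector. -/
lemma natCard_rankWeight_one_add_one_le (hη : 1 ≤ η) :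
    1 + (Nat.card {x : Fin η → K // rankWeight F x = 1} : ℝ) ≤
      gammaConst (Nat.card F) *
        (Nat.card F : ℝ) ^ ((Module.finrank F K : ℝ) + η - 1) := by
  have : Module.Finite F K := Module.Finite.of_finite
  have hm : 1 ≤ Module.finrank F K := Module.finrank_pos
  have h1 := natCard_rankWeight_le (F := F) (K := K) (η := η) 1 hm
  have hq := two_le_card F
  generalize Nat.card F = q at *
  generalize Module.finrank F K = m at *
  have hq' : (2 : ℝ) ≤ q := by exact_mod_cast hq
  have hγ : (q : ℝ) / (q - 1) ≤ gammaConst q := by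
    refine le_trans (le_of_eq ?_) (prod_range_le_gammaConst hq 1)
    have : (q : ℝ) - 1 ≠ 0 := by linarith
    have h5 : 1 - (q : ℝ)⁻¹ ≠ 0 := by
      intro h; apply this; field_simp at h; linarith
    simp
    field_simp
  have e : (q : ℝ) ^ ((m : ℝ) + η - 1) = (q : ℝ) ^ (m + η) / q := by
    rw [Real.rpow_sub (by positivity), Real.rpow_one, ← Nat.cast_add, Real.rpow_natCast]
  have e2 : gaussBinom q m 1 = ((q : ℝ) ^ m - 1) / (q - 1) := by simp [gaussBinom]
  rw [e2, one_mul] at h1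
  have h2 : (q : ℝ) ≤ (q : ℝ) ^ η := le_self_pow₀ (by linarith) (by omega)
  rw [e]
  refine le_trans ?_ (mul_le_mul_of_nonneg_right hγ (by positivity))
  have e3 : (q : ℝ) / (q - 1) * ((q : ℝ) ^ (m + η) / q) = (q : ℝ) ^ (m + η) / (q - 1) := by
    field_simp
  rw [e3]
  refine (add_le_add_right h1 1).trans ?_
  have h3 : (0 : ℝ) < q - 1 := by linarith
  rw [le_div_iff₀ h3, add_mul, div_mul_eq_mul_div, div_mul_cancel₀ _ h3.ne', pow_add]
  nlinarith

/-- For block weights `c i` with sum `s`, the exponents add up to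
`s (m + η) - ∑ i, c i ^ 2`, and `∑ i, c i ^ 2 ≥ s ^ 2 / ℓ`. -/
lemma natCard_sumRankWeight_le (hℓ : 1 ≤ ℓ) (s : ℕ) :
    (Nat.card {x : Fin ℓ → Fin η → K // sumRankWeight F x = s} : ℝ) ≤
      ((ℓ + s - 1).choose (ℓ - 1) : ℝ) * (gammaConst (Nat.card F) ^ ℓ *
        (Nat.card F : ℝ) ^ ((s : ℝ) * ((Module.finrank F K : ℝ) + η - s / ℓ))) := by
  have hq := two_le_card F
  have hq' : (1 : ℝ) ≤ Nat.card F := by exact_mod_cast (by omega : 1 ≤ Nat.card F)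
  have hγ := one_le_gammaConst hq
  rw [natCard_sumRankWeight_eq, Nat.cast_sum, ← card_piAntidiag_fin ℓ s hℓ, ← nsmul_eq_mul]
  refine Finset.sum_le_card_nsmul _ _ _ fun c hc => ?_
  have hc : ∑ i, c i = s := by simpa using hc
  rw [Nat.cast_prod]
  refine (Finset.prod_le_prod (fun _ _ => Nat.cast_nonneg _)
    fun i _ => natCard_rankWeight_le_rpow (F := F) (K := K) (η := η) (c i)).trans ?_
  rw [Finset.prod_mul_distrib, Finset.prod_const, Finset.card_univ, Fintype.card_fin,
    ← Real.rpow_sum_of_pos (by linarith)]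
  refine mul_le_mul_of_nonneg_left (Real.rpow_le_rpow_of_exponent_le hq' ?_) (by positivity)
  have hc' : ∑ i, (c i : ℝ) = s := by exact_mod_cast hc
  have hsq := sq_sum_le_card_mul_sum_sq (s := Finset.univ) (f := fun i => (c i : ℝ))
  rw [hc', Finset.card_univ, Fintype.card_fin] at hsq
  have hℓ' : (0 : ℝ) < ℓ := by exact_mod_cast hℓ
  have e1 : ∑ i, (c i : ℝ) * ((Module.finrank F K : ℝ) + η - c i) =
      s * ((Module.finrank F K : ℝ) + η) - ∑ i, (c i : ℝ) ^ 2 := by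
    rw [← hc', Finset.sum_mul, ← Finset.sum_sub_distrib]
    exact Finset.sum_congr rfl fun i _ => by ring
  have e2 : (s : ℝ) ^ 2 / ℓ ≤ ∑ i, (c i : ℝ) ^ 2 := by
    rw [div_le_iff₀ hℓ']
    linarith
  rw [e1]
  calc _ ≤ (s : ℝ) * ((Module.finrank F K : ℝ) + η) - (s : ℝ) ^ 2 / ℓ := by linarith
    _ = _ := by ring

/-- The analogue of `natCard_rankWeight_one_add_one_le` for the sum-rank weight: exactly one block
of a vector of weight one is nonzero. -/
lemma natCard_sumRankWeight_one_add_one_le (hℓ : 1 ≤ ℓ) (hη : 1 ≤ η) :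
    1 + (Nat.card {x : Fin ℓ → Fin η → K // sumRankWeight F x = 1} : ℝ) ≤
      ((ℓ + 1 - 1).choose (ℓ - 1) : ℝ) * (gammaConst (Nat.card F) ^ ℓ *
        (Nat.card F : ℝ) ^ (((1 : ℕ) : ℝ) * ((Module.finrank F K : ℝ) + η - (1 : ℕ) / ℓ))) := by
  classical
  have hq := two_le_card F
  have hq' : (1 : ℝ) ≤ Nat.card F := by exact_mod_cast (by omega : 1 ≤ Nat.card F)
  have hγ := one_le_gammaConst hq
  have hprod : ∀ c ∈ Finset.piAntidiag (Finset.univ : Finset (Fin ℓ)) 1,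
      ∏ i, Nat.card {x : Fin η → K // rankWeight F x = c i} =
        Nat.card {x : Fin η → K // rankWeight F x = 1} := by
    intro c hc
    have hc : ∑ i, c i = 1 := by simpa using hc
    obtain ⟨j, -, hj, hj'⟩ : ∃ j ∈ Finset.univ, c j = 1 ∧ ∀ i, i ≠ j → c i = 0 := by
      obtain ⟨j, hj, hj0⟩ := Finset.exists_ne_zero_of_sum_ne_zero (hc.trans_ne one_ne_zero)
      have := Finset.add_sum_erase Finset.univ c (Finset.mem_univ j)
      refine ⟨j, hj, by omega, fun i hi => ?_⟩
      have := Finset.single_le_sum (f := c) (s := Finset.univ.erase j) (fun _ _ => Nat.zero_le _)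
        (Finset.mem_erase.2 ⟨hi, Finset.mem_univ i⟩)
      omega
    rw [Finset.prod_eq_single j, hj]
    · intro i _ hi
      rw [hj' i hi]
      simp [rankWeight_eq_zero]
    · simp
  rw [natCard_sumRankWeight_eq, Finset.sum_const_nat hprod, ← card_piAntidiag_fin ℓ 1 hℓ]
  have h1 := natCard_rankWeight_one_add_one_le (F := F) (K := K) (η := η) hη
  have hc : (1 : ℝ) ≤ (Finset.piAntidiag (Finset.univ : Finset (Fin ℓ)) 1).card := by
    rw [card_piAntidiag_fin ℓ 1 hℓ]
    exact_mod_cast Nat.choose_pos (by omega)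
  have h2 : gammaConst (Nat.card F) * (Nat.card F : ℝ) ^ ((Module.finrank F K : ℝ) + η - 1) ≤
      gammaConst (Nat.card F) ^ ℓ *
        (Nat.card F : ℝ) ^ (((1 : ℕ) : ℝ) * ((Module.finrank F K : ℝ) + η - (1 : ℕ) / ℓ)) := by
    refine mul_le_mul (le_self_pow₀ hγ (by omega)) (Real.rpow_le_rpow_of_exponent_le hq' ?_)
      (by positivity) (by positivity)
    have : (1 : ℝ) / ℓ ≤ 1 := div_le_one_of_le₀ (by exact_mod_cast hℓ) (by positivity)
    push_cast
    linarith
  push_cast at h2 ⊢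
  nlinarith

/-- A ball of radius `t` is the union of spheres of radius `s ≤ t`. The bound for the sphere of
radius `t` exceeds the bounds for the smaller ones that are nonempty, and the centre is counted
together with the sphere of radius one, which makes `t` terms. -/
lemma natCard_ball_le (hℓ : 1 ≤ ℓ) (hη : 1 ≤ η) {t : ℕ} (ht : 1 ≤ t) (htn : t ≤ ℓ * η) :
    (Nat.card {x : Fin ℓ → Fin η → K // sumRankWeight F x ≤ t} : ℝ) ≤
      t * (((ℓ + t - 1).choose (ℓ - 1) : ℝ) * (gammaConst (Nat.card F) ^ ℓ *
        (Nat.card F : ℝ) ^ ((t : ℝ) * ((Module.finrank F K : ℝ) + η - t / ℓ)))) := by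
  classical
  have : Module.Finite F K := Module.Finite.of_finite
  have hm : 1 ≤ Module.finrank F K := Module.finrank_pos
  have hq := two_le_card F
  have hq' : (1 : ℝ) ≤ Nat.card F := by exact_mod_cast (by omega : 1 ≤ Nat.card F)
  have hγ := one_le_gammaConst hq
  have hball : Nat.card {x : Fin ℓ → Fin η → K // sumRankWeight F x ≤ t} =
      ∑ s ∈ Finset.range (t + 1),
        Nat.card {x : Fin ℓ → Fin η → K // sumRankWeight F x = s} := by
    have := Fintype.ofFinite K
    simp only [Nat.card_eq_fintype_card, Fintype.card_subtype]
    rw [Finset.card_eq_sum_card_fiberwise (f := fun x => sumRankWeight F x)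
      (t := Finset.range (t + 1))]
    · refine Finset.sum_congr rfl fun s hs => ?_
      rw [Finset.filter_filter]
      congr 1
      ext x
      have := Finset.mem_range.1 hs
      simp only [Finset.mem_filter, Finset.mem_univ, true_and]
      omega
    · intro x hx
      have : sumRankWeight F x ≤ t := by simpa using hx
      simpa using Nat.lt_succ_of_le this
  -- `s (m + η - s / ℓ)` is not increasing up to `s = t` if `η > m`, but only the values
  -- `s ≤ ℓ m` occur, and for these `s + t ≤ ℓ (m + η)`
  have hmono (s : ℕ) (hst : s ≤ t) (hs : s ≤ ℓ * Module.finrank F K) :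
      ((ℓ + s - 1).choose (ℓ - 1) : ℝ) * (gammaConst (Nat.card F) ^ ℓ *
        (Nat.card F : ℝ) ^ ((s : ℝ) * ((Module.finrank F K : ℝ) + η - s / ℓ))) ≤
      ((ℓ + t - 1).choose (ℓ - 1) : ℝ) * (gammaConst (Nat.card F) ^ ℓ *
        (Nat.card F : ℝ) ^ ((t : ℝ) * ((Module.finrank F K : ℝ) + η - t / ℓ))) := by
    refine mul_le_mul ?_ (mul_le_mul_of_nonneg_left
      (Real.rpow_le_rpow_of_exponent_le hq' ?_) (by positivity)) (by positivity) (by positivity)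
    · exact_mod_cast Nat.choose_le_choose _ (by omega)
    · have hℓ' : (0 : ℝ) < ℓ := by exact_mod_cast hℓ
      have h1 : (s : ℝ) ≤ t := by exact_mod_cast hst
      have h2 : (s : ℝ) ≤ ℓ * Module.finrank F K := by exact_mod_cast hs
      have h3 : (t : ℝ) ≤ ℓ * η := by exact_mod_cast htn
      have h4 : ((s : ℝ) + t) / ℓ ≤ Module.finrank F K + η := by
        rw [div_le_iff₀ hℓ']
        linarith
      have h5 := mul_nonneg (sub_nonneg.2 h1) (sub_nonneg.2 h4)
      have e : ((t : ℝ) - s) * (Module.finrank F K + η - (s + t) / ℓ) =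
        t * (Module.finrank F K + η - t / ℓ) - s * (Module.finrank F K + η - s / ℓ) := by ring
      linarith
  obtain ⟨u, rfl⟩ : ∃ u, t = u + 1 := ⟨t - 1, by omega⟩
  set B : ℝ := ((ℓ + (u + 1) - 1).choose (ℓ - 1) : ℝ) * (gammaConst (Nat.card F) ^ ℓ *
        (Nat.card F : ℝ) ^
          (((u + 1 : ℕ) : ℝ) * ((Module.finrank F K : ℝ) + η - (u + 1 : ℕ) / ℓ))) with hB
  have hB0 : 0 ≤ B := by positivity
  have h0 : Nat.card {x : Fin ℓ → Fin η → K // sumRankWeight F x = 0} = 1 := by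
    simp [sumRankWeight_eq_zero]
  have h1 := (natCard_sumRankWeight_one_add_one_le (F := F) (K := K) hℓ hη).trans
    (hmono 1 ht (Nat.mul_pos hℓ hm))
  have h2 : ∀ s ∈ Finset.range u,
      (Nat.card {x : Fin ℓ → Fin η → K // sumRankWeight F x = s + 1 + 1} : ℝ) ≤ B := by
    intro s hs
    have hs := Finset.mem_range.1 hs
    by_cases hsm : s + 1 + 1 ≤ ℓ * Module.finrank F K
    · exact (natCard_sumRankWeight_le hℓ (s + 1 + 1)).trans (hmono _ (by omega) hsm)
    · have : IsEmpty {x : Fin ℓ → Fin η → K // sumRankWeight F x = s + 1 + 1} :=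
        ⟨fun x => hsm (x.2 ▸ sumRankWeight_le x.1)⟩
      rwa [Nat.card_of_isEmpty, Nat.cast_zero]
  have h3 := Finset.sum_le_card_nsmul _ _ _ h2
  rw [Finset.card_range, nsmul_eq_mul] at h3
  rw [hball, Finset.sum_range_succ', Finset.sum_range_succ', h0]
  push_cast
  linarith

end Weights
/-! ### Subspaces of small sum-rank weight and the Singleton bound -/

section Anticodes

variable {F K : Type*} [Field F] [Field K] [Algebra F K] {η ℓ : ℕ}

lemma sumRankWeight_le_length (x : Fin ℓ → Fin η → K) : sumRankWeight F x ≤ ℓ * η := by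
  refine (Finset.sum_le_card_nsmul _ _ η fun i _ => ?_).trans (by simp)
  exact (finrank_range_le_card (x i)).trans (by simp)

lemma exists_sumRankWeight_eq_minDist {C : Submodule K (Fin ℓ → Fin η → K)} (hC : C ≠ ⊥) :
    ∃ x ∈ C, x ≠ 0 ∧ sumRankWeight F x = minDist F C := by
  obtain ⟨z, hz, hz0⟩ := C.exists_mem_ne_zero_of_ne_bot hC
  obtain ⟨x, hx, y, hy, hxy, h⟩ := Nat.sInf_mem
    (s := {d | ∃ x ∈ C, ∃ y ∈ C, x ≠ y ∧ sumRankDist F x y = d}) ⟨_, z, hz, 0, C.zero_mem, hz0, rfl⟩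
  exact ⟨x - y, C.sub_mem hx hy, sub_ne_zero.2 hxy, h⟩

lemma minDist_le {C : Submodule K (Fin ℓ → Fin η → K)} {x : Fin ℓ → Fin η → K} (hx : x ∈ C)
    (hx0 : x ≠ 0) : minDist F C ≤ sumRankWeight F x :=
  Nat.sInf_le ⟨x, hx, 0, C.zero_mem, hx0, by rw [sumRankDist, sub_zero]⟩

lemma exists_sum_eq_of_le_mul {b : ℕ} (ℓ r : ℕ) (hr : r ≤ ℓ * b) :
    ∃ d : Fin ℓ → ℕ, (∀ i, d i ≤ b) ∧ ∑ i, d i = r := by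
  induction ℓ generalizing r with
  | zero => exact ⟨0, fun i => i.elim0, by simp at hr; simp [hr]⟩
  | succ ℓ ih =>
    rw [Nat.succ_mul] at hr
    obtain ⟨d, h1, h2⟩ := ih (r - min r b) (by omega)
    refine ⟨Fin.cons (min r b) d, Fin.cases (by simp) h1, ?_⟩
    rw [Fin.sum_cons, h2]
    omega

lemma eq_zero_of_sumRankWeight_lt {C : Submodule K (Fin ℓ → Fin η → K)} {D : ℕ}
    (hD : minDist F C = D + 1) {W : Submodule F (Fin ℓ → Fin η → K)}
    (hW : ∀ x ∈ W, sumRankWeight F x ≤ D) : ∀ x ∈ W, x ∈ C → x = 0 := by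
  intro x hxW hxC
  by_contra hx0
  have := minDist_le (F := F) hxC hx0
  have := hW x hxW
  omega

variable [Finite K]

/-- The `F`-space of the vectors of length `η` supported on the first `u` coordinates. -/
lemma exists_block_of_coordinates (u : ℕ) (hu : u ≤ η) :
    ∃ L : Submodule F (Fin η → K), Module.finrank F L = Module.finrank F K * u ∧
      ∀ x ∈ L, rankWeight F x ≤ u := by
  have : Module.Finite F K := Module.Finite.of_finite
  have hinj : Function.Injective (Fin.castLE hu) := Fin.castLE_injective hu
  refine ⟨LinearMap.range
    ((Function.ExtendByZero.linearMap K (Fin.castLE hu)).restrictScalars F), ?_, ?_⟩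
  · rw [LinearMap.finrank_range_of_inj, Module.finrank_pi_fintype]
    · simp [mul_comm]
    · intro f g h
      ext i
      have := congrFun h (Fin.castLE hu i)
      simpa [Function.ExtendByZero.linearMap_apply, hinj.extend_apply] using this
  · rintro _ ⟨f, rfl⟩
    have hle : Submodule.span F (Set.range (Function.extend (Fin.castLE hu) f 0)) ≤
        Submodule.span F (Set.range f) := by
      rw [Submodule.span_le]
      rintro _ ⟨j, rfl⟩
      by_cases hj : ∃ i, Fin.castLE hu i = j
      · obtain ⟨i, rfl⟩ := hj
        rw [hinj.extend_apply]
        exact Submodule.subset_span ⟨i, rfl⟩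
      · rw [Function.extend_apply' _ _ _ hj]
        exact Submodule.zero_mem _
    exact (Submodule.finrank_mono hle).trans ((finrank_range_le_card f).trans (by simp))

/-- The `F`-space of the vectors of length `η` with entries in a `u`-dimensional `F`-subspace
of `K`. -/
lemma exists_block_of_subspace (u : ℕ) (hu : u ≤ Module.finrank F K) :
    ∃ L : Submodule F (Fin η → K), Module.finrank F L = η * u ∧
      ∀ x ∈ L, rankWeight F x ≤ u := by
  have : Module.Finite F K := Module.Finite.of_finite
  let b := Module.finBasis F K
  let U : Submodule F K := Submodule.span F (Set.range (b ∘ Fin.castLE hu))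
  have hU : Module.finrank F U = u := by
    rw [finrank_span_eq_card (b.linearIndependent.comp _ (Fin.castLE_injective hu)),
      Fintype.card_fin]
  refine ⟨LinearMap.range (U.subtype.compLeft (Fin η)), ?_, ?_⟩
  · rw [LinearMap.finrank_range_of_inj, Module.finrank_pi_fintype]
    · simp [hU]
    · intro f g h
      ext i
      exact congrFun h i
  · rintro _ ⟨f, rfl⟩
    refine (Submodule.finrank_mono (Submodule.span_le.2 ?_)).trans hU.le
    rintro _ ⟨j, rfl⟩
    exact (f j).2

/-- Subspaces of the single blocks, as provided by `H` for each weight `u ≤ b`, combine to a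
subspace of weight at most `r ≤ ℓ b`. -/
lemma exists_pi_of_blocks {b c : ℕ}
    (H : ∀ u ≤ b, ∃ L : Submodule F (Fin η → K), Module.finrank F L = c * u ∧
      ∀ x ∈ L, rankWeight F x ≤ u) {r : ℕ} (hr : r ≤ ℓ * b) :
    ∃ W : Submodule F (Fin ℓ → Fin η → K), Module.finrank F W = c * r ∧
      ∀ x ∈ W, sumRankWeight F x ≤ r := by
  have : Module.Finite F K := Module.Finite.of_finite
  obtain ⟨d, hd, rfl⟩ := exists_sum_eq_of_le_mul ℓ r hr
  choose L hL hw using fun i => H (d i) (hd i)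
  let f : (∀ i, L i) →ₗ[F] (Fin ℓ → Fin η → K) :=
    LinearMap.pi fun i => (L i).subtype ∘ₗ LinearMap.proj i
  refine ⟨LinearMap.range f, ?_, ?_⟩
  · rw [LinearMap.finrank_range_of_inj, Module.finrank_pi_fintype, Finset.mul_sum]
    · exact Finset.sum_congr rfl fun i _ => hL i
    · intro x y h
      funext i
      exact Subtype.ext (congrFun h i)
  · rintro _ ⟨x, rfl⟩
    exact Finset.sum_le_sum fun i _ => hw i _ (x i).2

/-- An `F`-space of dimension `m r` in the ball of radius `r`: `r` coordinates are free. -/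
lemma exists_anticode_of_coordinates {r : ℕ} (hr : r ≤ ℓ * η) :
    ∃ W : Submodule F (Fin ℓ → Fin η → K), Module.finrank F W = Module.finrank F K * r ∧
      ∀ x ∈ W, sumRankWeight F x ≤ r :=
  exists_pi_of_blocks exists_block_of_coordinates hr

/-- An `F`-space of dimension `η r` in the ball of radius `r`: the entries of the `i`-th block are
confined to an `F`-subspace `U i` of `K`, and the dimensions of the `U i` sum to `r`. -/
lemma exists_anticode_of_subspaces {r : ℕ} (hr : r ≤ ℓ * Module.finrank F K) :
    ∃ W : Submodule F (Fin ℓ → Fin η → K), Module.finrank F W = η * r ∧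
      ∀ x ∈ W, sumRankWeight F x ≤ r :=
  exists_pi_of_blocks exists_block_of_subspace hr

lemma sumRankWeight_smul_le (c : K) (x : Fin ℓ → Fin η → K) :
    sumRankWeight F (c • x) ≤ sumRankWeight F x := by
  have : Module.Finite F K := Module.Finite.of_finite
  refine Finset.sum_le_sum fun i _ => ?_
  have : Submodule.span F (Set.range ((c • x) i)) =
      (Submodule.span F (Set.range (x i))).map (LinearMap.mulLeft F c) := by
    rw [Submodule.map_span, ← Set.range_comp]
    rfl
  rw [rankWeight, this]
  exact Submodule.finrank_map_le _ _

lemma exists_minDist_eq_add_one {C : Submodule K (Fin ℓ → Fin η → K)} (hC : C ≠ ⊥) :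
    ∃ D, minDist F C = D + 1 ∧ D + 1 ≤ ℓ * η ∧ D + 1 ≤ ℓ * Module.finrank F K := by
  obtain ⟨x, -, hx0, hx⟩ := exists_sumRankWeight_eq_minDist (F := F) hC
  have h1 := sumRankWeight_le_length (F := F) x
  have h2 := sumRankWeight_le (F := F) x
  have h3 : sumRankWeight F x ≠ 0 := fun h => hx0 (sumRankWeight_eq_zero.1 h)
  exact ⟨minDist F C - 1, by omega, by omega, by omega⟩

lemma finrank_add_finrank_le_of_avoiding {C : Submodule K (Fin ℓ → Fin η → K)}
    {W : Submodule F (Fin ℓ → Fin η → K)} (h : ∀ x ∈ W, x ∈ C → x = 0) :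
    Module.finrank F K * Module.finrank K C + Module.finrank F W ≤
      Module.finrank F K * (ℓ * η) := by
  have : Module.Finite F K := Module.Finite.of_finite
  have hdisj : Disjoint (C.restrictScalars F) W := by
    rw [Submodule.disjoint_def]
    exact fun x hxC hxW => h x hxW hxC
  have h1 := Submodule.finrank_add_finrank_le_of_disjoint hdisj
  have h2 : Module.finrank F (C.restrictScalars F) =
      Module.finrank F K * Module.finrank K C := (Module.finrank_mul_finrank F K C).symm
  have h3 : Module.finrank F (Fin ℓ → Fin η → K) = Module.finrank F K * (ℓ * η) := by
    simp [Module.finrank_pi_fintype]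
    ring
  rwa [h2, h3] at h1

/-- The two parts of the Singleton bound, multiplied by `m` and stated for `D = d - 1`. -/
lemma singleton_bound {C : Submodule K (Fin ℓ → Fin η → K)} {D : ℕ}
    (hC : C ≠ ⊥) (hD : minDist F C = D + 1) :
    Module.finrank F K * Module.finrank K C + Module.finrank F K * D ≤
        Module.finrank F K * (ℓ * η) ∧
      Module.finrank F K * Module.finrank K C + η * D ≤ Module.finrank F K * (ℓ * η) := by
  obtain ⟨D', hD', h1, h2⟩ := exists_minDist_eq_add_one (F := F) hC
  obtain rfl : D = D' := by omega
  obtain ⟨W, hW, hw⟩ := exists_anticode_of_coordinates (F := F) (K := K) (η := η) (ℓ := ℓ)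
    (r := D) (by omega)
  obtain ⟨W', hW', hw'⟩ := exists_anticode_of_subspaces (F := F) (K := K) (η := η) (ℓ := ℓ)
    (r := D) (by omega)
  have h3 := finrank_add_finrank_le_of_avoiding (eq_zero_of_sumRankWeight_lt hD hw)
  have h4 := finrank_add_finrank_le_of_avoiding (eq_zero_of_sumRankWeight_lt hD hw')
  rw [hW] at h3
  rw [hW'] at h4
  exact ⟨h3, h4⟩

/-- The minimum distance of an MSRD code is determined by its dimension: which of the two parts of
the Singleton bound is the smaller one depends only on the comparison of `η` with `m`. -/
lemma IsMSRD.minDist_eq {C : Submodule K (Fin ℓ → Fin η → K)} {D t : ℕ} (h : IsMSRD F C)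
    (hD : minDist F C = D + 1) (ht : ℓ * η = t + Module.finrank K C) :
    (η ≤ Module.finrank F K → D = t) ∧
      (Module.finrank F K < η → η * D = Module.finrank F K * t) := by
  have : Module.Finite F K := Module.Finite.of_finite
  have hm : (0 : ℚ) < Module.finrank F K := by exact_mod_cast Module.finrank_pos (R := F) (M := K)
  rw [IsMSRD, hD] at h
  generalize Module.finrank F K = m at *
  generalize Module.finrank K C = k at *
  have ht' : (ℓ : ℚ) * η = t + k := by exact_mod_cast ht
  have hD0 : (0 : ℚ) ≤ D := Nat.cast_nonneg D
  -- the second part of the bound is `n - η D / m`, the first one is `n - D`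
  have e : (η : ℚ) / m * (ℓ * m - ((D + 1 : ℕ) : ℚ) + 1) = ℓ * η - η * D / m := by
    field_simp
    push_cast
    ring
  rw [e] at h
  push_cast at h
  refine ⟨fun hle => ?_, fun hlt => ?_⟩
  · have hle : (η : ℚ) ≤ m := by exact_mod_cast hle
    have : (η : ℚ) * D / m ≤ D := by
      rw [div_le_iff₀ hm]
      nlinarith
    rw [min_eq_left (by linarith)] at h
    exact_mod_cast (by linarith : (D : ℚ) = t)
  · have hlt : (m : ℚ) ≤ η := by exact_mod_cast hlt.le
    have : (D : ℚ) ≤ η * D / m := by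
      rw [le_div_iff₀ hm]
      nlinarith
    rw [min_eq_right (by linarith)] at h
    have h2 : (η : ℚ) * D / m = t := by linarith
    rw [div_eq_iff hm.ne'] at h2
    have h3 : η * D = t * m := by exact_mod_cast h2
    rw [h3, mul_comm]

/-- A code of minimum distance greater than `n - k` attains the Singleton bound.
For `η > m` the hypothesis on the weights is never satisfied unless `k = n`, by the second part
of the Singleton bound. -/
lemma isMSRD_of_forall_lt {C : Submodule K (Fin ℓ → Fin η → K)} {t : ℕ} (hC : C ≠ ⊥)
    (ht : ℓ * η = t + Module.finrank K C)
    (h : ∀ x ∈ C, x ≠ 0 → t < sumRankWeight F x) : IsMSRD F C := by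
  have : Module.Finite F K := Module.Finite.of_finite
  have hm0 : 0 < Module.finrank F K := Module.finrank_pos
  have hm : (0 : ℚ) < Module.finrank F K := by exact_mod_cast hm0
  obtain ⟨D, hD, -, -⟩ := exists_minDist_eq_add_one (F := F) hC
  obtain ⟨x, hxC, hx0, hx⟩ := exists_sumRankWeight_eq_minDist (F := F) hC
  have h0 := h x hxC hx0
  obtain ⟨h1, h2⟩ := singleton_bound hC hD
  rw [← mul_add] at h1
  have h3 := Nat.le_of_mul_le_mul_left h1 hm0
  obtain rfl : D = t := by omega
  rw [IsMSRD, hD]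
  generalize Module.finrank F K = m at *
  generalize Module.finrank K C = k at *
  have ht' : (ℓ : ℚ) * η = D + k := by exact_mod_cast ht
  have h2' : (m : ℚ) * k + η * D ≤ m * (ℓ * η) := by exact_mod_cast h2
  have e : (η : ℚ) / m * (ℓ * m - ((D + 1 : ℕ) : ℚ) + 1) = ℓ * η - η * D / m := by
    field_simp
    push_cast
    ring
  have h4 : (η : ℚ) * D / m ≤ D := by
    rw [div_le_iff₀ hm]
    rw [ht'] at h2'
    linarith
  rw [e, min_eq_left]
  · push_cast
    linarith
  · push_cast
    linarith

end Anticodes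

/-! ### Counting MSRD codes -/

section Counting

variable {F K : Type*} [Field F] [Field K] [Finite K] [Algebra F K] {η ℓ : ℕ}

lemma ne_bot_of_finrank {K V : Type*} [Field K] [AddCommGroup V] [Module K V] {C : Submodule K V}
    {k : ℕ} (hk : 1 ≤ k) (hC : Module.finrank K C = k) : C ≠ ⊥ := by
  rintro rfl
  rw [finrank_bot] at hC
  omega

lemma finrank_ambient (K : Type*) [Field K] (ℓ η : ℕ) :
    Module.finrank K (Fin ℓ → Fin η → K) = ℓ * η := by
  simp [Module.finrank_pi_fintype]

/-- The union bound: a code that is not MSRD contains a punctured line of nonzero vectors of weight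
at most `n - k`. -/
lemma natCard_not_isMSRD_mul_le {t k : ℕ} (hk : 1 ≤ k) (hn : ℓ * η = t + k) :
    (Nat.card {C : Submodule K (Fin ℓ → Fin η → K) //
        Module.finrank K C = k ∧ ¬ IsMSRD F C} : ℝ) *
        (((Nat.card K : ℝ) - 1) * ((Nat.card K : ℝ) ^ (ℓ * η) - 1)) ≤
      Nat.card {C : Submodule K (Fin ℓ → Fin η → K) // Module.finrank K C = k} *
        ((Nat.card K : ℝ) ^ k - 1) *
        (Nat.card {x : Fin ℓ → Fin η → K // sumRankWeight F x ≤ t} - 1) := by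
  classical
  have : Finite (Submodule K (Fin ℓ → Fin η → K)) := Finite.of_injective _ SetLike.coe_injective
  have := Fintype.ofFinite K
  have := Fintype.ofFinite (Submodule K (Fin ℓ → Fin η → K))
  have hQ := two_le_card K
  have hQ' : (2 : ℝ) ≤ Nat.card K := by exact_mod_cast hQ
  have hQn : (1 : ℝ) < (Nat.card K : ℝ) ^ (ℓ * η) := one_lt_pow₀ (by linarith) (by omega)
  let B : Finset (Fin ℓ → Fin η → K) := {x | x ≠ 0 ∧ sumRankWeight F x ≤ t}
  let S : Finset (Submodule K (Fin ℓ → Fin η → K)) := {C | Module.finrank K C = k ∧ ¬ IsMSRD F C}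
  have hB : B.card + 1 = Nat.card {x : Fin ℓ → Fin η → K // sumRankWeight F x ≤ t} := by
    rw [Nat.card_eq_fintype_card, Fintype.card_subtype,
      ← Finset.card_insert_of_notMem (a := (0 : Fin ℓ → Fin η → K)) (by simp [B])]
    congr 1
    ext x
    by_cases hx : x = 0
    · simp [hx, sumRankWeight_eq_zero.2]
    · simp [hx, B]
  have hS : Nat.card {C : Submodule K (Fin ℓ → Fin η → K) //
      Module.finrank K C = k ∧ ¬ IsMSRD F C} = S.card := by
    rw [Nat.card_eq_fintype_card, Fintype.card_subtype]
  have hbelow : ∀ C ∈ S, Nat.card K - 1 ≤ (B.bipartiteBelow (fun x C => x ∈ C) C).card := by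
    intro C hC
    obtain ⟨hCk, hC⟩ := (Finset.mem_filter.1 hC).2
    obtain ⟨x, hxC, hx0, hx⟩ : ∃ x ∈ C, x ≠ 0 ∧ sumRankWeight F x ≤ t := by
      by_contra! h
      exact hC (isMSRD_of_forall_lt (ne_bot_of_finrank hk hCk) (hCk.symm ▸ hn) h)
    rw [← Nat.card_units, Nat.card_eq_fintype_card, ← Finset.card_univ]
    refine Finset.card_le_card_of_injOn (fun c => (c : K) • x) ?_ ?_
    · intro c _
      simp only [Finset.coe_filter, Finset.bipartiteBelow, Set.mem_ofPred_eq, B, Finset.mem_filter,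
        Finset.mem_univ, true_and]
      exact ⟨⟨smul_ne_zero c.ne_zero hx0, (sumRankWeight_smul_le _ _).trans hx⟩, C.smul_mem _ hxC⟩
    · intro c _ c' _ h
      exact Units.ext (smul_left_injective K hx0 h)
  have h1 : (S.card : ℝ) * ((Nat.card K : ℝ) - 1) ≤
      ∑ x ∈ B, ((S.bipartiteAbove (fun x C => x ∈ C) x).card : ℝ) := by
    have := Finset.card_nsmul_le_sum _ _ _ hbelow
    rw [← Finset.sum_card_bipartiteAbove_eq_sum_card_bipartiteBelow, smul_eq_mul] at this
    rw [← Nat.cast_one, ← Nat.cast_sub (by omega)]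
    exact_mod_cast this
  have h2 : ∀ x ∈ B, ((S.bipartiteAbove (fun x C => x ∈ C) x).card : ℝ) *
      ((Nat.card K : ℝ) ^ (ℓ * η) - 1) ≤
      Nat.card {C : Submodule K (Fin ℓ → Fin η → K) // Module.finrank K C = k} *
        ((Nat.card K : ℝ) ^ k - 1) := by
    intro x hx
    have hx0 : x ≠ 0 := (Finset.mem_filter.1 hx).2.1
    rw [← natCard_subspaces_mem_mul hx0, finrank_ambient]
    refine mul_le_mul_of_nonneg_right (Nat.cast_le.2 ?_) (by linarith)
    rw [Nat.card_eq_fintype_card, Fintype.card_subtype]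
    refine Finset.card_le_card fun C hC => ?_
    simp only [Finset.bipartiteAbove, S, Finset.mem_filter, Finset.mem_univ, true_and] at hC ⊢
    exact ⟨hC.1.1, hC.2⟩
  have h3 := Finset.sum_le_card_nsmul _ _ _ h2
  rw [← Finset.sum_mul, nsmul_eq_mul] at h3
  rw [hS, ← hB, ← mul_assoc]
  refine (mul_le_mul_of_nonneg_right h1 (by linarith)).trans (h3.trans_eq ?_)
  push_cast
  ring

variable [Finite F]

/-- All MSRD codes of dimension `k` avoid a common `F`-subspace of codimension `m k`. -/
lemma natCard_isMSRD_le {t k : ℕ} (hk : 1 ≤ k) (hn : ℓ * η = t + k) :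
    (Nat.card {C : Submodule K (Fin ℓ → Fin η → K) // Module.finrank K C = k ∧ IsMSRD F C} : ℝ) ≤
      (Nat.card K : ℝ) ^ (k * t) := by
  have : Finite (Submodule K (Fin ℓ → Fin η → K)) := Finite.of_injective _ SetLike.coe_injective
  rcases isEmpty_or_nonempty
      {C : Submodule K (Fin ℓ → Fin η → K) // Module.finrank K C = k ∧ IsMSRD F C} with
    h | ⟨C₀, hk₀, h₀⟩
  · rw [Nat.card_of_isEmpty, Nat.cast_zero]
    positivity
  obtain ⟨D, hD, hD1, hD2⟩ := exists_minDist_eq_add_one (F := F) (ne_bot_of_finrank hk hk₀)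
  have hkey := h₀.minDist_eq hD (hk₀.symm ▸ hn)
  -- `D` is the same for all MSRD codes of dimension `k`, hence so is `W`
  obtain ⟨W, hW, hw⟩ : ∃ W : Submodule F (Fin ℓ → Fin η → K),
      Module.finrank F W = Module.finrank F K * t ∧ ∀ x ∈ W, sumRankWeight F x ≤ D := by
    rcases le_or_gt η (Module.finrank F K) with h | h
    · obtain rfl := hkey.1 h
      exact exists_anticode_of_coordinates (by omega)
    · rw [← hkey.2 h]
      exact exists_anticode_of_subspaces (by omega)
  refine le_trans ?_ (natCard_avoiding_le ((finrank_ambient K ℓ η).trans hn) W hW)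
  refine Nat.cast_le.2 (Nat.card_le_card_of_injective
    (fun C => ⟨C.1, C.2.1, eq_zero_of_sumRankWeight_lt ?_ hw⟩) ?_)
  · obtain ⟨C, hC, h⟩ := C
    obtain ⟨D', hD', -, -⟩ := exists_minDist_eq_add_one (F := F) (ne_bot_of_finrank hk hC)
    have hkey' := h.minDist_eq hD' (hC.symm ▸ hn)
    rw [hD']
    rcases le_or_gt η (Module.finrank F K) with h | h
    · rw [hkey.1 h, hkey'.1 h]
    · rw [Nat.eq_of_mul_eq_mul_left (by omega) ((hkey'.2 h).trans (hkey.2 h).symm)]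
  · intro C C' h
    exact Subtype.ext (congrArg (fun z => z.1) h)

end Counting
end SumRank

theorem mainTheorem7 {F K : Type*} [Field F] [Finite F] [Field K] [Finite K] [Algebra F K]
    (q m ℓ η n k : ℕ) (hq : Nat.card F = q) (hm : Module.finrank F K = m)
    (hℓ : 1 ≤ ℓ) (hη : 1 ≤ η) (hn : n = ℓ * η) (hk : 1 ≤ k) (hkn : k ≤ n) :
    SumRank.probMSRD F K ℓ η k ≤
        1 - (SumRank.gaussBinom (q ^ m) n k)⁻¹ *
          ∑ h ∈ Finset.Icc 1 (n - k), SumRank.gaussBinom (q ^ m) (n - k) h *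
            ∑ s ∈ Finset.Icc h (n - k),
              SumRank.gaussBinom (q ^ m) (n - k - h) (s - h) *
                SumRank.gaussBinom (q ^ m) (n - s) (n - k) *
                (-1 : ℝ) ^ (s - h) * (q : ℝ) ^ (m * Nat.choose (s - h) 2) ∧
      (k < n →
        1 - ((q : ℝ) ^ (m * k) - 1) / (((q : ℝ) ^ m - 1) * ((q : ℝ) ^ (m * n) - 1)) *
            (((n : ℝ) - k) * (Nat.choose (ℓ + n - k - 1) (ℓ - 1) : ℝ) *
              SumRank.gammaConst q ^ ℓ *
              (q : ℝ) ^ (((n : ℝ) - k) * ((m : ℝ) + η - ((n : ℝ) - k) / ℓ)) - 1) ≤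
          SumRank.probMSRD F K ℓ η k) := by
  classical
  have : Module.Finite F K := Module.Finite.of_finite
  have : Finite (Submodule K (Fin ℓ → Fin η → K)) := Finite.of_injective _ SetLike.coe_injective
  have hQ : Nat.card K = q ^ m := by rw [Module.natCard_eq_pow_finrank (K := F), hq, hm]
  have hQ2 : 2 ≤ q ^ m := hQ ▸ SumRank.two_le_card K
  obtain ⟨t, rfl⟩ : ∃ t, n = t + k := ⟨n - k, by omega⟩
  have hall := SumRank.natCard_subspaces (K := K) (V := Fin ℓ → Fin η → K) (k := k)
    (by rw [SumRank.finrank_ambient]; omega)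
  rw [SumRank.finrank_ambient, ← hn, hQ] at hall
  have hG := SumRank.gaussBinom_pos hQ2 hkn
  have hprob : SumRank.probMSRD F K ℓ η k =
      (Nat.card {C : Submodule K (Fin ℓ → Fin η → K) //
        Module.finrank K C = k ∧ SumRank.IsMSRD F C} : ℝ) / SumRank.gaussBinom (q ^ m) (t + k) k := by
    rw [← hall]
    rfl
  rw [hprob, Nat.add_sub_cancel]
  constructor
  · have hup := SumRank.natCard_isMSRD_le (F := F) (K := K) hk hn.symm
    have hid := SumRank.gaussBinom_eq_pow_add_sum hQ2 t k
    rw [← SumRank.gaussBinom_symm hQ2 (Nat.le_add_right t k), Nat.add_sub_cancel_left] at hid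
    simp only [pow_mul (q : ℝ) m]
    rw [hQ] at hup
    push_cast at hup hid
    rw [div_le_iff₀ hG, sub_mul, inv_mul_eq_div, div_mul_cancel₀ _ hG.ne']
    linarith
  · intro hlt
    have hlow := SumRank.natCard_not_isMSRD_mul_le (F := F) (K := K) hk hn.symm
    have hball := SumRank.natCard_ball_le (F := F) (K := K) hℓ hη (t := t) (by omega) (by omega)
    have hsplit : Nat.card {C : Submodule K (Fin ℓ → Fin η → K) // Module.finrank K C = k} =
        Nat.card {C : Submodule K (Fin ℓ → Fin η → K) //
          Module.finrank K C = k ∧ SumRank.IsMSRD F C} +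
        Nat.card {C : Submodule K (Fin ℓ → Fin η → K) //
          Module.finrank K C = k ∧ ¬ SumRank.IsMSRD F C} := by
      have := Fintype.ofFinite (Submodule K (Fin ℓ → Fin η → K))
      simp only [Nat.card_eq_fintype_card, Fintype.card_subtype]
      rw [← Finset.filter_filter, ← Finset.filter_filter, Finset.card_filter_add_card_filter_not]
    have hsplit' := congrArg (Nat.cast (R := ℝ)) hsplit
    rw [hall] at hsplit' hlow
    rw [hq, hm] at hball
    rw [hQ, ← hn] at hlow
    push_cast at hsplit' hlow hball ⊢
    rw [show ℓ + (t + k) - k - 1 = ℓ + t - 1 by omega, add_sub_cancel_right]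
    have hQ' : (2 : ℝ) ≤ (q : ℝ) ^ m := by exact_mod_cast hQ2
    have h1 : (0 : ℝ) < ((q : ℝ) ^ m) ^ k - 1 :=
      sub_pos.2 (one_lt_pow₀ (by linarith) (by omega))
    have h2 : (0 : ℝ) < ((q : ℝ) ^ m) ^ (t + k) - 1 :=
      sub_pos.2 (one_lt_pow₀ (by linarith) (by omega))
    have h3 : (0 : ℝ) < (q : ℝ) ^ m - 1 := by linarith
    rw [pow_mul, pow_mul, le_div_iff₀ hG, sub_mul, one_mul, hsplit', sub_le_iff_le_add,
      add_le_add_iff_left, ← hsplit', div_mul_eq_mul_div, div_mul_eq_mul_div,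
      le_div_iff₀ (mul_pos h3 h2)]
    refine hlow.trans ?_
    rw [mul_comm (SumRank.gaussBinom _ _ _), mul_right_comm]
    refine mul_le_mul_of_nonneg_right (mul_le_mul_of_nonneg_left ?_ h1.le) hG.le
    linarith
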